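/- Let $n\ge 0$, let $C_2^n$ be the set of binary $n$-tuples, and let the symmetric group $S_n$ act on it by permuting coordinates. The binary Burnside process is the Markov chain on $C_2^n$ with transition matrix $$K_n(x,y)=\frac1{|G_x|}\sum_{s\in G_x\cap G_y}\frac1{|\mathfrak X_s|},$$ where $G_x\subseteq S_n$ is the stabilizer of $x$ and $\mathfrak X_s=\{z\in C_2^n: z^s=z\}$. It acts on the space $L(C_2^n)$ of complex functions by $(K_nf)(x)=\sum_yK_n(x,y)f(y)$ and commutes with the action of $S_n$ on $L(C_2^n)$. For $k\ge 0$ put $\beta_k=\frac1{2^{4k}}\binom{2k}{k}^2$. For a partition $\lambda$ of $n$ let $S^\lambda$ be the Specht module over $\mathbb C$, and let $W^\lambda\subseteq L(C_2^n)$ be the $S^\lambda$-isotypic component, that is, the sum of all submodules of $L(C_2^n)$ isomorphic to $S^\lambda$. Then $K_n$ maps $W^\lambda$ to itself; let $K_n^\lambda$ be the restriction of $K_n$ to $W^\lambda$, and let $\tilde K_n^\lambda$ be the operator $\varphi\mapsto K_n\circ\varphi$ on $\mathrm{Hom}_{S_n}(S^\lambda,L(C_2^n))$. The following hold. 1. The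 map $\varphi\otimes s\mapsto\varphi(s)$ is an isomorphism $\mathrm{Hom}_{S_n}(S^\lambda,L(C_2^n))\otimes S^\lambda\to W^\lambda$, under which $K_n^\lambda$ corresponds to $\tilde K_n^\lambda\otimes I_{S^\lambda}$. 2. Let $\lambda=(n-m,m)$ with $0\le m\le n/2$, and let $0\le k\le n/2$. If $m\le\min(2k,n-2k)$, then $\beta_k$ is an eigenvalue of $\tilde K_n^\lambda$ of multiplicity $1$ and an eigenvalue of $K_n^\lambda$ of multiplicity $\dim S^\lambda$. Otherwise $\beta_k$ is an eigenvalue of neither operator. Multiplicities are both geometric and algebraic. 3. There are no other nonzero eigenvalues: for every partition $\lambda$ of $n$, a complex number $z\ne0$ is an eigenvalue of $K_n^\lambda$ (equivalently, of $\tilde K_n^\lambda$) if and only if $\lambda=(n-m,m)$ and $z=\beta_k$ for some integers $0\le m,k\le n/2$ with $m\le\min(2k,n-2k)$. -/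

import Mathlib

open scoped TensorProduct MonoidAlgebra

/-- The set `C_2^n` of binary `n`-tuples. -/
abbrev BinTuple (n : ℕ) : Type := Fin n → Bool

/-- The permutation `s` of the coordinates fixes the binary tuple `x`. -/
abbrev Fixes {n : ℕ} (s : Equiv.Perm (Fin n)) (x : BinTuple n) : Prop :=
  ∀ i, x (s i) = x i

/-- Transition matrix of the binary Burnside process:
`K(x, y) = |G_x|⁻¹ ∑_{s ∈ G_x ∩ G_y} |X_s|⁻¹`, where `G_x` is the stabilizer of `x` in `S_n` and
`X_s` is the set of binary tuples fixed by `s`. -/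
def burnsideMatrix (n : ℕ) (x y : BinTuple n) : ℚ :=
  1 / (Fintype.card {s : Equiv.Perm (Fin n) // Fixes s x} : ℚ) *
    ∑ s : Equiv.Perm (Fin n) with Fixes s x ∧ Fixes s y,
      1 / (Fintype.card {z : BinTuple n // Fixes s z} : ℚ)

/-- `β_k = 2^{-4k} (2k choose k)^2`. -/
def burnsideBeta (k : ℕ) : ℚ := 1 / 2 ^ (4 * k) * ((2 * k).choose k : ℚ) ^ 2

/-- The action of `S_n` on the space of functions on `C_2^n` by permuting coordinates:
`(σ f)(x) = f (σ⁻¹ x)` with `(σ x) i = x (σ⁻¹ i)`, so that `(σ⁻¹ x) i = x (σ i)`. -/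
noncomputable def binRep (n : ℕ) : Representation ℂ (Equiv.Perm (Fin n)) (BinTuple n → ℂ) where
  toFun σ := LinearMap.funLeft ℂ ℂ fun x : BinTuple n => x ∘ σ
  map_one' := rfl
  map_mul' _ _ := rfl

/-- The space `L(C_2^n)` of complex functions on `C_2^n`, as a module over `ℂ[S_n]`. -/
abbrev BinModule (n : ℕ) : Type := (binRep n).asModule

theorem burnsideMatrix_comp (n : ℕ) (σ : Equiv.Perm (Fin n)) (x y : BinTuple n) :
    burnsideMatrix n (x ∘ σ) (y ∘ σ) = burnsideMatrix n x y := by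
  have key : ∀ (s : Equiv.Perm (Fin n)) (z : BinTuple n),
      Fixes ((MulAut.conj σ).toEquiv s) z ↔ Fixes s (z ∘ σ) := by
    intro s z
    constructor
    · intro h i
      simpa using h (σ i)
    · intro h i
      simpa using h (σ⁻¹ i)
  unfold burnsideMatrix
  congr 1
  · rw [Fintype.card_congr ((MulAut.conj σ).toEquiv.subtypeEquiv (q := fun s => Fixes s x)
      fun s => (key s x).symm)]
  · refine Finset.sum_equiv (MulAut.conj σ).toEquiv (fun s => ?_) (fun s _ => ?_)
    · simp only [Finset.mem_filter, Finset.mem_univ, true_and, key]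
    · rw [Fintype.card_congr (((Equiv.arrowCongr σ (Equiv.refl Bool)).symm.subtypeEquiv
        fun z => (key s z)))]

/-- The Burnside operator on functions, `(K f)(x) = ∑_y K(x, y) f(y)`. -/
noncomputable def burnsideOp (n : ℕ) : (BinTuple n → ℂ) →ₗ[ℂ] (BinTuple n → ℂ) :=
  Matrix.toLin' (Matrix.of fun x y => (burnsideMatrix n x y : ℂ))

theorem burnsideOp_comm (n : ℕ) (σ : Equiv.Perm (Fin n)) (f : BinTuple n → ℂ) :
    burnsideOp n (binRep n σ f) = binRep n σ (burnsideOp n f) := by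
  funext x
  have h1 : ∀ (g : BinTuple n → ℂ) (x : BinTuple n),
      burnsideOp n g x = ∑ y, (burnsideMatrix n x y : ℂ) * g y := by
    intro g x
    simp [burnsideOp, Matrix.mulVec, dotProduct]
  have h2 : ∀ (g : BinTuple n → ℂ) (x : BinTuple n), binRep n σ g x = g (x ∘ σ) :=
    fun _ _ => rfl
  rw [h2, h1, h1]
  refine Fintype.sum_equiv (Equiv.arrowCongr σ.symm (Equiv.refl Bool)) _ _ (fun y => ?_)
  have h3 : (Equiv.arrowCongr σ.symm (Equiv.refl Bool)) y = y ∘ σ := by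
    funext i
    simp
  rw [h3, burnsideMatrix_comp, h2]

/-- The Burnside operator `K_n` on `L(C_2^n)`, which commutes with the action of `S_n`. -/
noncomputable def burnsideK (n : ℕ) :
    BinModule n →ₗ[ℂ[Equiv.Perm (Fin n)]] BinModule n :=
  MonoidAlgebra.equivariantOfLinearOfComm
    (((binRep n).asModuleEquiv.symm.toLinearMap ∘ₗ burnsideOp n) ∘ₗ
      (binRep n).asModuleEquiv.toLinearMap) (by
    intro σ v
    simp only [Representation.single_smul, one_smul]
    exact burnsideOp_comm n σ v)

section Specht

/- A tableau of shape `μ` is a bijection `t` from the set of entries to the cells of `μ`: the entry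
`i` stands in the cell `t i`, in row `(t i).1.1` and column `(t i).1.2`. -/
variable {n : ℕ} {μ : YoungDiagram} (t : Fin n ≃ μ.cells)

/-- The sum in `ℂ[S_n]` of the permutations that preserve every row of the tableau `t`. -/
noncomputable def rowSum : ℂ[Equiv.Perm (Fin n)] :=
  ∑ σ : Equiv.Perm (Fin n) with ∀ i, (t (σ i)).1.1 = (t i).1.1, MonoidAlgebra.single σ 1

/-- The signed sum in `ℂ[S_n]` of the permutations that preserve every column of `t`. -/
noncomputable def signedColumnSum : ℂ[Equiv.Perm (Fin n)] :=
  ∑ σ : Equiv.Perm (Fin n) with ∀ i, (t (σ i)).1.2 = (t i).1.2,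
    MonoidAlgebra.single σ (((Equiv.Perm.sign σ : ℤˣ) : ℤ) : ℂ)

/-- The Specht module `S^μ`, as the left ideal of `ℂ[S_n]` generated by the Young symmetrizer
`κ_t ρ_t` of a tableau `t` of shape `μ`. (With `σ ρ_t` in the role of the tabloid of `σ t`, the
element `κ_t ρ_t` is the polytabloid of `t`, and the left ideal is the span of all polytabloids.) -/
noncomputable def Specht : Submodule ℂ[Equiv.Perm (Fin n)] ℂ[Equiv.Perm (Fin n)] :=
  Submodule.span _ {signedColumnSum t * rowSum t}

/-- The sum of all submodules of `L(C_2^n)` isomorphic to `S^μ`. -/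
noncomputable def spechtCopies : Submodule ℂ[Equiv.Perm (Fin n)] (BinModule n) :=
  isotypicComponent ℂ[Equiv.Perm (Fin n)] (BinModule n) (Specht t)

/-- The multiplicity space `Hom_{S_n}(S^μ, L(C_2^n))`. -/
abbrev SpechtHom : Type := Specht t →ₗ[ℂ[Equiv.Perm (Fin n)]] BinModule n

/-- The operator induced by `K_n` on the multiplicity space of `S^μ`, namely `φ ↦ K_n ∘ φ`. -/
noncomputable def reducedK : Module.End ℂ (SpechtHom t) where
  toFun φ := burnsideK n ∘ₗ φ
  map_add' φ ψ := LinearMap.comp_add _ _ _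
  map_smul' c φ := by
    ext s
    exact LinearMap.map_smul_of_tower (burnsideK n) c (φ s)

/-- `K_n` restricted to the copies of `S^μ`, given that it maps their sum to itself. -/
noncomputable def restrictedK (h : ∀ w ∈ spechtCopies t, burnsideK n w ∈ spechtCopies t) :
    Module.End ℂ (spechtCopies t) :=
  ((burnsideK n).restrict h).restrictScalars ℂ

end Specht

/-- `μ` is the partition `(n - m, m)` of `n`, with `m ≤ n - m`. -/
def IsTwoRow (μ : YoungDiagram) (n m : ℕ) : Prop :=
  2 * m ≤ n ∧ μ.rowLen 0 = n - m ∧ μ.rowLen 1 = m ∧ μ.rowLen 2 = 0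

/-- The number `z` has both geometric and algebraic multiplicity `d` as an eigenvalue of `f`
(it is not an eigenvalue if `d = 0`, for `f` acting on a finite-dimensional space). -/
def HasMultiplicity {V : Type*} [AddCommGroup V] [Module ℂ V] (f : Module.End ℂ V) (z : ℂ)
    (d : ℕ) : Prop :=
  Module.finrank ℂ (f.eigenspace z) = d ∧ Module.finrank ℂ (f.maxGenEigenspace z) = d

/-! The plan is to diagonalize $K_n$ equivariantly and then apply Young's rule for two-row shapes.

Closed form. Since $|\mathfrak X_s|=2^{c(s)}$, with $c(s)$ the number of cycles, both $|G_x|$ and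
the sum in $K_n(x,y)$ are sums of $a^{c(s)}$ over the stabilizer of a colouring, with $a=1$ for $x$
and $a=1/2$ for the pair $(x,y)$. Such a sum is a product of rising factorials, one per colour
(`sum_stabilizer_eq_urn`). Hence the kernel behaves like a Pólya urn: it is reversible, and summing
out a coordinate $y_j$ gives the kernel on the remaining coordinates.

Eigenfunctions. These two properties make $f_S(y)=\prod_{i\in S}(-1)^{y_i}/\prod_b b_S(y)!$, with
$b_S(y)$ the number of entries $b$ of $y$ in $S$, an eigenfunction for every set $S$ of coordinates.
The eigenvalue depends only on $|S|$: it is $\beta_k$ if $|S|=2k$ and $0$ if $|S|$ is odd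
(`urnEigenvalue_two_mul`, `urnEigenvalue_odd`). The $f_S$ form a basis permuted by $S_n$, so $K_n$
is conjugate, by an equivariant automorphism, to multiplication by a function of the number of ones.
As the $\beta_k$ are distinct, the $\beta_k$-eigenspace is the permutation module on $2k$-subsets.

Multiplicities. A map out of the Specht module is determined by its value at the generator
$\kappa_t\rho_t$. Antisymmetry along columns kills this value if there are three rows. For shape
$(n-m,m)$ it determines the value up to a scalar on the tuples with $j$ ones, and forces $m\le j\le
n-m$ where the value is nonzero; conversely an explicit map exists for each such $j$. The same
proportionality shows that the endomorphisms of $S^\lambda$ are scalars, and with semisimplicity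
this gives the isomorphism $\mathrm{Hom}\otimes S^\lambda\cong W^\lambda$. -/

/-! ### Rising factorials and extending a permutation by one point -/

/-- The rising factorial `a (a + 1) ⋯ (a + k - 1)`. -/
def rising (a : ℚ) (k : ℕ) : ℚ := ∏ i ∈ Finset.range k, (a + i)

theorem rising_succ (a : ℚ) (k : ℕ) : rising a (k + 1) = rising a k * (a + k) :=
  Finset.prod_range_succ _ _

theorem rising_pos {a : ℚ} (ha : 0 < a) (k : ℕ) : 0 < rising a k :=
  Finset.prod_pos fun _ _ => by positivity

/-- The permutation encoded by `(p, e)` arises from `e` by inserting the point `0` into the cycle of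
`p`, or as a new fixed point if `p = 0`. Once `0` and `p` have the same colour, the swap of the two
is invisible to `c`. -/
theorem comp_decomposeFin_iff {κ : Type*} {n : ℕ} (c : Fin (n + 1) → κ) (p : Fin (n + 1))
    (e : Equiv.Perm (Fin n)) :
    (∀ i, c (Equiv.Perm.decomposeFin.symm (p, e) i) = c i) ↔
      c p = c 0 ∧ ∀ i, c (e i).succ = c i.succ := by
  rw [Fin.forall_fin_succ]
  simp only [Equiv.Perm.decomposeFin_symm_apply_zero, Equiv.Perm.decomposeFin_symm_apply_succ]
  refine and_congr_right fun hp => forall_congr' fun i => ?_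
  have : c (Equiv.swap 0 p (e i).succ) = c (e i).succ := by
    by_cases h : (e i).succ = p
    · rw [h, Equiv.swap_apply_right, hp]
    · rw [Equiv.swap_apply_of_ne_of_ne (Fin.succ_ne_zero _) h]
  rw [this]

/-! ### Cycle-weighted sums over stabilizers and the closed form of the kernel -/

section Urn

variable {ι κ : Type*} [DecidableEq κ] [Fintype κ]

/-- The product over all colours `q` of the rising factorials of `a` of length the number of
elements of `S` that have the colour `q`. -/
def urn (a : ℚ) (c : ι → κ) (S : Finset ι) : ℚ := ∏ q, rising a (S.filter (c · = q)).card

theorem urn_insert [DecidableEq ι] (a : ℚ) (c : ι → κ) {S : Finset ι} {j : ι} (hj : j ∉ S) :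
    urn a c (insert j S) = (a + (S.filter (c · = c j)).card) * urn a c S := by
  have h : ∀ q, rising a ((insert j S).filter (c · = q)).card =
      (if c j = q then a + (S.filter (c · = c j)).card else 1) *
        rising a (S.filter (c · = q)).card := by
    intro q
    rw [Finset.filter_insert]
    split_ifs with hq
    · rw [Finset.card_insert_of_notMem (by simp [hj]), rising_succ, hq, mul_comm]
    · rw [one_mul]
  simp only [urn, h, Finset.prod_mul_distrib, Finset.prod_ite_eq, Finset.mem_univ, if_true]

theorem urn_pos {a : ℚ} (ha : 0 < a) (c : ι → κ) (S : Finset ι) : 0 < urn a c S :=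
  Finset.prod_pos fun _ _ => rising_pos ha _

theorem urn_congr (a : ℚ) {c c' : ι → κ} {S : Finset ι} (h : ∀ i ∈ S, c i = c' i) :
    urn a c S = urn a c' S := by
  unfold urn
  refine Finset.prod_congr rfl fun q _ => ?_
  rw [Finset.filter_congr fun i hi => by rw [h i hi]]

theorem urn_map {ι' : Type*} (a : ℚ) (c : ι → κ) (g : ι' ↪ ι) (S : Finset ι') :
    urn a c (S.map g) = urn a (c ∘ g) S := by
  unfold urn
  refine Finset.prod_congr rfl fun q _ => ?_
  rw [Finset.filter_map, Finset.card_map]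
  rfl

/-- A weight on permutations that is multiplied by `a` when a fixed point is adjoined and does not
change when a point is inserted into a cycle, summed over the stabilizer of a colouring. -/
theorem sum_stabilizer_eq_urn (a : ℚ) (F : ∀ n, Equiv.Perm (Fin n) → ℚ) (h0 : ∀ e, F 0 e = 1)
    (hF : ∀ n p e, F (n + 1) (Equiv.Perm.decomposeFin.symm (p, e)) =
      (if p = 0 then a else 1) * F n e) (n : ℕ) (c : Fin n → κ) :
    ∑ s : Equiv.Perm (Fin n) with ∀ i, c (s i) = c i, F n s = urn a c Finset.univ := by
  induction n with
  | zero =>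
    simp [urn, rising, h0, Finset.filter_true_of_mem]
  | succ n ih =>
    have hu : (Finset.univ : Finset (Fin (n + 1))) =
        insert 0 (Finset.univ.map (Fin.succEmb n)) := by
      ext i
      refine Fin.cases ?_ (fun j => ?_) i <;> simp
    rw [Finset.sum_filter, ← Equiv.Perm.decomposeFin.symm.sum_comp, Fintype.sum_prod_type]
    simp only [comp_decomposeFin_iff, hF]
    have : ∀ (p : Fin (n + 1)) (e : Equiv.Perm (Fin n)),
        (if c p = c 0 ∧ ∀ i, c (e i).succ = c i.succ then (if p = 0 then a else 1) * F n e
          else 0) = (if c p = c 0 then if p = 0 then a else 1 else 0) *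
            (if ∀ i, (c ∘ Fin.succ) (e i) = (c ∘ Fin.succ) i then F n e else 0) := by
      intro p e
      by_cases h1 : c p = c 0 <;> by_cases h2 : ∀ i, c (e i).succ = c i.succ <;> simp [h1, h2]
    simp only [this]
    rw [← Finset.sum_mul_sum, ← Finset.sum_filter (s := Finset.univ)
      (p := fun e : Equiv.Perm (Fin n) => ∀ i, (c ∘ Fin.succ) (e i) = (c ∘ Fin.succ) i), ih]
    -- The admissible `p` contribute `a` for `p = 0` and `1` for each other point of the colour of
    -- `0`, which is the factor that `urn` gains from the point `0`.
    rw [hu, urn_insert _ _ (by simp), urn_map]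
    congr 1
    rw [← hu, Fin.sum_univ_succ, Finset.filter_map, Finset.card_map]
    simp [Fin.succ_ne_zero]
    rfl

end Urn

/-- A fixed tuple is constant on cycles: its value at a new fixed point is free, while its value at
a point inserted into a cycle is forced. -/
theorem card_fixed_decomposeFin (n : ℕ) (p : Fin (n + 1)) (e : Equiv.Perm (Fin n)) :
    Fintype.card {z : BinTuple (n + 1) // Fixes (Equiv.Perm.decomposeFin.symm (p, e)) z} =
      (if p = 0 then 2 else 1) * Fintype.card {z : BinTuple n // Fixes e z} := by
  induction p using Fin.cases with
  | zero =>
    rw [if_pos rfl, ← Fintype.card_bool, ← Fintype.card_prod]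
    refine Fintype.card_congr
      { toFun := fun z => (z.1 0, ⟨Fin.tail z.1, ((comp_decomposeFin_iff _ _ _).1 z.2).2⟩)
        invFun := fun q => ⟨Fin.cons q.1 q.2.1, (comp_decomposeFin_iff _ _ _).2
          ⟨rfl, fun i => by simpa using q.2.2 i⟩⟩
        left_inv := fun z => Subtype.ext (Fin.cons_self_tail _)
        right_inv := fun q => by simp }
  | succ j =>
    rw [if_neg (Fin.succ_ne_zero j), one_mul]
    refine Fintype.card_congr
      { toFun := fun z => ⟨Fin.tail z.1, ((comp_decomposeFin_iff _ _ _).1 z.2).2⟩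
        invFun := fun q => ⟨Fin.cons (q.1 j) q.1, (comp_decomposeFin_iff _ _ _).2
          ⟨by simp, fun i => by simpa using q.2 i⟩⟩
        left_inv := fun z => Subtype.ext ?_
        right_inv := fun q => by simp }
    have h := ((comp_decomposeFin_iff _ _ _).1 z.2).1
    conv_rhs => rw [← Fin.cons_self_tail z.1, ← h]
    rfl

/-- The kernel of the binary Burnside process on the coordinates in `S`, in closed form. -/
def urnKernel {ι : Type*} (S : Finset ι) (x y : ι → Bool) : ℚ :=
  urn (1 / 2) (fun i => (x i, y i)) S / urn 1 x S

theorem burnsideMatrix_eq_urnKernel (n : ℕ) (x y : BinTuple n) :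
    burnsideMatrix n x y = urnKernel Finset.univ x y := by
  have h1 := sum_stabilizer_eq_urn 1 (fun _ _ => 1) (fun _ => rfl) (by simp) n x
  have h2 := sum_stabilizer_eq_urn (1 / 2)
    (fun n s => 1 / (Fintype.card {z : BinTuple n // Fixes s z} : ℚ))
    (fun e => by
      have : Fintype.card {z : BinTuple 0 // Fixes e z} = 1 :=
        Fintype.card_eq_one_iff.2 ⟨⟨default, fun i => i.elim0⟩, fun z => Subsingleton.elim _ _⟩
      rw [this]; norm_num)
    (fun n p e => by
      rw [card_fixed_decomposeFin]
      split_ifs <;> push_cast <;> simp [mul_comm])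
    n (fun i => (x i, y i))
  rw [urnKernel, ← h1, ← h2, burnsideMatrix, Finset.sum_const, nsmul_one, ← Fintype.card_subtype,
    one_div_mul_eq_div]
  simp only [Prod.mk.injEq, ← forall_and, Fixes]

/-! ### Consistency, reversibility and eigenfunctions of the kernel -/

section Kernel

variable {ι : Type*} [DecidableEq ι]

/-- The tuple `y` with its entry at `i` negated. -/
def flipAt (i : ι) (y : ι → Bool) : ι → Bool := Function.update y i (!y i)

@[simp] theorem flipAt_self (i : ι) (y : ι → Bool) : flipAt i y i = !y i := by simp [flipAt]

theorem flipAt_of_ne {i j : ι} (h : j ≠ i) (y : ι → Bool) : flipAt i y j = y j := by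
  simp [flipAt, h]

@[simp] theorem flipAt_flipAt (i : ι) (y : ι → Bool) : flipAt i (flipAt i y) = y := by
  simp [flipAt]

theorem sum_flipAt [Fintype ι] {M : Type*} [AddCommMonoid M] (i : ι) (F : (ι → Bool) → M) :
    ∑ y, F (flipAt i y) = ∑ y, F y :=
  Fintype.sum_equiv (Function.Involutive.toPerm (flipAt i) (flipAt_flipAt i)) _ _ fun _ => rfl

omit [DecidableEq ι] in
theorem urnKernel_congr {S : Finset ι} {x x' y y' : ι → Bool} (hx : ∀ i ∈ S, x i = x' i)
    (hy : ∀ i ∈ S, y i = y' i) : urnKernel S x y = urnKernel S x' y' := by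
  rw [urnKernel, urnKernel, urn_congr 1 hx, urn_congr (1 / 2) fun i hi => by rw [hx i hi, hy i hi]]

/-- This is the Pólya urn rule. The new coordinate multiplies the numerator by `1/2` plus the count
of its pair of entries; for the two values of `y j` these factors add up to one plus the count of `x
j`, the factor gained by the denominator. -/
theorem urnKernel_flipAt_add {S : Finset ι} {j : ι} (hj : j ∉ S) (x y : ι → Bool) :
    urnKernel (insert j S) x y + urnKernel (insert j S) x (flipAt j y) = urnKernel S x y := by
  have hne : ∀ i ∈ S, i ≠ j := fun i hi h => hj (h ▸ hi)
  have hc : (S.filter fun i => (x i, y i) = (x j, y j)).card +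
      (S.filter fun i => (x i, flipAt j y i) = (x j, flipAt j y j)).card =
      (S.filter fun i => x i = x j).card := by
    rw [Finset.card_filter, Finset.card_filter, Finset.card_filter, ← Finset.sum_add_distrib]
    refine Finset.sum_congr rfl fun i hi => ?_
    rw [flipAt_of_ne (hne i hi), flipAt_self]
    by_cases h : x i = x j <;> cases y i <;> cases y j <;> simp [h]
  have hu : urn (1 / 2) (fun i => (x i, flipAt j y i)) S = urn (1 / 2) (fun i => (x i, y i)) S :=
    urn_congr _ fun i hi => by rw [flipAt_of_ne (hne i hi)]
  have hpos := urn_pos one_pos x S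
  have hq : ((S.filter fun i => (x i, y i) = (x j, y j)).card : ℚ) +
      (S.filter fun i => (x i, flipAt j y i) = (x j, flipAt j y j)).card =
      (S.filter fun i => x i = x j).card := by exact_mod_cast hc
  rw [urnKernel, urnKernel, urnKernel, urn_insert _ _ hj, urn_insert _ _ hj, urn_insert _ _ hj, hu,
    ← hq]
  field_simp
  ring

omit [DecidableEq ι] in
-- Detailed balance: both sides are the product attached to the colouring by pairs, which is
-- symmetric in `x` and `y`.
theorem urn_mul_urnKernel_comm (S : Finset ι) (x y : ι → Bool) :
    urn 1 x S * urnKernel S x y = urn 1 y S * urnKernel S y x := by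
  have h : urn (1 / 2) (fun i => (x i, y i)) S = urn (1 / 2) (fun i => (y i, x i)) S := by
    unfold urn
    refine Fintype.prod_equiv (Equiv.prodComm _ _) _ _ fun q => ?_
    congr 2
    ext i
    simp [Prod.ext_iff, and_comm]
  rw [urnKernel, urnKernel, mul_div_cancel₀ _ (urn_pos one_pos x S).ne',
    mul_div_cancel₀ _ (urn_pos one_pos y S).ne', h]

variable [Fintype ι]

/-- The kernels on different sets of coordinates are consistent. -/
theorem sum_urnKernel_mul (S : Finset ι) (x : ι → Bool) (g : (ι → Bool) → ℚ)
    (hg : ∀ i ∉ S, ∀ y, g (flipAt i y) = g y) :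
    ∑ y, urnKernel Finset.univ x y * g y =
      (1 / 2) ^ (Sᶜ).card * ∑ y, urnKernel S x y * g y := by
  suffices h : ∀ U : Finset ι, Disjoint S U → ∑ y, urnKernel (S ∪ U) x y * g y =
      (1 / 2) ^ U.card * ∑ y, urnKernel S x y * g y by
    simpa using h Sᶜ disjoint_compl_right
  intro U
  induction U using Finset.induction_on with
  | empty => simp
  | insert j U hj ih =>
    intro hd
    rw [Finset.disjoint_insert_right] at hd
    have h2 : ∑ y, urnKernel (S ∪ insert j U) x y * g y +
        ∑ y, urnKernel (S ∪ insert j U) x y * g y = ∑ y, urnKernel (S ∪ U) x y * g y := by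
      -- Pairing `y` with its flip at `j` sums out that coordinate, because `g` does not depend on
      -- it.
      nth_rewrite 2 [← sum_flipAt j]
      rw [← Finset.sum_add_distrib]
      refine Finset.sum_congr rfl fun y _ => ?_
      rw [hg j hd.1, ← add_mul, Finset.union_insert, urnKernel_flipAt_add (by simp [hj, hd.1])]
    rw [Finset.card_insert_of_notMem hj, pow_succ]
    linarith [ih hd.2]

/-- The character `y ↦ ∏_{i ∈ S} (-1)^{y i}`. -/
def bitChar (S : Finset ι) (y : ι → Bool) : ℚ := ∏ i ∈ S, if y i then -1 else 1

omit [DecidableEq ι] [Fintype ι] in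
theorem bitChar_congr {S : Finset ι} {y y' : ι → Bool} (h : ∀ i ∈ S, y i = y' i) :
    bitChar S y = bitChar S y' :=
  Finset.prod_congr rfl fun i hi => by rw [h i hi]

omit [Fintype ι] in
theorem bitChar_flipAt {S : Finset ι} {i : ι} (hi : i ∈ S) (y : ι → Bool) :
    bitChar S (flipAt i y) = -bitChar S y := by
  rw [bitChar, bitChar, ← Finset.mul_prod_erase _ _ hi, ← Finset.mul_prod_erase _ _ hi,
    Finset.prod_congr rfl fun j hj => by rw [flipAt_of_ne (Finset.ne_of_mem_erase hj)]]
  cases h : y i <;> simp [h]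

omit [DecidableEq ι] [Fintype ι] in
theorem bitChar_mul_self (S : Finset ι) (y : ι → Bool) : bitChar S y * bitChar S y = 1 := by
  rw [bitChar, ← Finset.prod_mul_distrib]
  exact Finset.prod_eq_one fun i _ => by split_ifs <;> norm_num

omit [DecidableEq ι] [Fintype ι] in
theorem bitChar_eq_pow (S : Finset ι) (y : ι → Bool) :
    bitChar S y = (-1) ^ (S.filter fun i => y i = true).card := by
  simp [bitChar, Finset.prod_ite]

theorem eq_of_flipAt_invariant {M : Type*} {F : (ι → Bool) → M}
    (h : ∀ i y, F (flipAt i y) = F y) (x y : ι → Bool) : F x = F y := by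
  have key : ∀ U : Finset ι, F (U.piecewise x y) = F y := by
    intro U
    induction U using Finset.induction_on with
    | empty => simp
    | insert i U hi ih =>
      rw [Finset.piecewise_insert, ← ih]
      by_cases hx : x i = U.piecewise x y i
      · rw [hx, Function.update_eq_self]
      · rw [← h i (U.piecewise x y), flipAt, Bool.eq_not.2 hx]
  simpa using key Finset.univ

theorem sum_flipAt_neg {i : ι} {F : (ι → Bool) → ℚ} (h : ∀ y, F (flipAt i y) = -F y) :
    ∑ y, F y = 0 := by
  have := sum_flipAt i F
  simp only [h, Finset.sum_neg_distrib] at this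
  linarith

/-- The sum of a function of the number of ones in `S`. -/
theorem sum_card_filter (S : Finset ι) (φ : ℕ → ℚ) :
    ∑ y : ι → Bool, φ (S.filter fun i => y i = true).card =
      2 ^ Fintype.card ι * (1 / 2) ^ S.card *
        ∑ a ∈ Finset.range (S.card + 1), (S.card.choose a : ℚ) * φ a := by
  induction S using Finset.induction_on generalizing φ with
  | empty => simp
  | insert j S hj ih =>
    have h2 : ∑ y : ι → Bool, φ ((insert j S).filter fun i => y i = true).card +
        ∑ y : ι → Bool, φ ((insert j S).filter fun i => y i = true).card =
        ∑ y : ι → Bool, φ (S.filter fun i => y i = true).card +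
          ∑ y : ι → Bool, φ ((S.filter fun i => y i = true).card + 1) := by
      nth_rewrite 2 [← sum_flipAt j]
      rw [← Finset.sum_add_distrib, ← Finset.sum_add_distrib]
      refine Finset.sum_congr rfl fun y _ => ?_
      have hS : (S.filter fun i => flipAt j y i = true) = S.filter fun i => y i = true :=
        Finset.filter_congr fun i hi => by rw [flipAt_of_ne (ne_of_mem_of_not_mem hi hj)]
      rw [Finset.filter_insert, Finset.filter_insert, hS, flipAt_self]
      cases h : y j
      · simp [hj]
      · simp [hj, add_comm]
    have hp : ∑ a ∈ Finset.range (S.card + 1 + 1), ((S.card + 1).choose a : ℚ) * φ a =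
        ∑ a ∈ Finset.range (S.card + 1), (S.card.choose a : ℚ) * φ a +
          ∑ a ∈ Finset.range (S.card + 1), (S.card.choose a : ℚ) * φ (a + 1) := by
      have hs : ∑ a ∈ Finset.range (S.card + 1), (S.card.choose (a + 1) : ℚ) * φ (a + 1) + φ 0 =
          ∑ a ∈ Finset.range (S.card + 1), (S.card.choose a : ℚ) * φ a := by
        have := Finset.sum_range_succ' (fun a => (S.card.choose a : ℚ) * φ a) (S.card + 1)
        rw [Finset.sum_range_succ] at this
        simpa using this.symm
      rw [Finset.sum_range_succ' _ (S.card + 1), ← hs]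
      simp only [Nat.choose_succ_succ, Nat.cast_add, add_mul, Finset.sum_add_distrib]
      simp
      ring
    rw [ih φ, ih fun a => φ (a + 1)] at h2
    rw [Finset.card_insert_of_notMem hj, hp, pow_succ]
    linarith

/-- The eigenvalue of the binary Burnside process on functions of degree `s`. -/
def urnEigenvalue (s : ℕ) : ℚ :=
  ∑ a ∈ Finset.range (s + 1), (s.choose a : ℚ) *
    ((-1) ^ a * (rising (1 / 2) a / rising 1 a * (rising (1 / 2) (s - a) / rising 1 (s - a))))

/-- Against the zero tuple only the colours `(true, false)` and `(false, false)` occur, so the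
summand depends only on the number of ones of `y` in `S`. The powers of two count the free
coordinates outside `S`. -/
theorem sum_bitChar_mul_urnKernel_zero (S : Finset ι) :
    ∑ y : ι → Bool, bitChar S y * urnKernel S y (fun _ => false) =
      2 ^ Fintype.card ι * (1 / 2) ^ S.card * urnEigenvalue S.card := by
  rw [urnEigenvalue, ← sum_card_filter]
  refine Finset.sum_congr rfl fun y _ => ?_
  have hf : (S.filter fun i => y i = false).card =
      S.card - (S.filter fun i => y i = true).card := by
    rw [← Finset.card_filter_add_card_filter_not (s := S) (p := fun i => y i = true)]
    simp
  rw [bitChar_eq_pow, urnKernel, urn, urn, Fintype.prod_prod_type]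
  simp [rising, hf]
  ring

/-- For `i` in `S`, adding the kernels at `x` and at its flip at `i` removes the coordinate `i`, and
the character sums a function independent of `y i` to zero. So the left side changes sign under
flips in `S`, hence is a multiple of the character, with the factor read off at `x = 0`. -/
theorem sum_bitChar_mul_urnKernel (S : Finset ι) (x : ι → Bool) :
    ∑ y : ι → Bool, bitChar S y * urnKernel S y x =
      2 ^ Fintype.card ι * (1 / 2) ^ S.card * urnEigenvalue S.card * bitChar S x := by
  have h : ∀ i x, bitChar S (flipAt i x) * ∑ y, bitChar S y * urnKernel S y (flipAt i x) =
      bitChar S x * ∑ y, bitChar S y * urnKernel S y x := by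
    intro i x
    by_cases hi : i ∈ S
    · have h0 : ∑ y, bitChar S y * urnKernel S y x +
          ∑ y, bitChar S y * urnKernel S y (flipAt i x) = 0 := by
        rw [← Finset.sum_add_distrib]
        refine sum_flipAt_neg (i := i) fun y => ?_
        rw [← mul_add, ← mul_add, bitChar_flipAt hi, neg_mul]
        congr 2
        have hk := fun y => urnKernel_flipAt_add (Finset.notMem_erase i S) y x
        simp only [Finset.insert_erase hi] at hk
        rw [hk, hk]
        exact urnKernel_congr (fun j hj => flipAt_of_ne (Finset.ne_of_mem_erase hj) y)
          fun _ _ => rfl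
      rw [bitChar_flipAt hi]
      linear_combination -bitChar S x * h0
    · have hx : ∀ j ∈ S, flipAt i x j = x j := fun j hj => flipAt_of_ne (ne_of_mem_of_not_mem hj hi) x
      rw [bitChar_congr hx]
      congr 1
      exact Finset.sum_congr rfl fun y _ => by rw [urnKernel_congr (fun _ _ => rfl) hx]
  have h1 := eq_of_flipAt_invariant (F := fun x => bitChar S x *
    ∑ y, bitChar S y * urnKernel S y x) h x (fun _ => false)
  have h2 : bitChar S (fun _ => false) = 1 := by simp [bitChar]
  simp only [h2, one_mul, sum_bitChar_mul_urnKernel_zero] at h1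
  linear_combination bitChar S x * h1 - (∑ y, bitChar S y * urnKernel S y x) * bitChar_mul_self S x

/-- The eigenfunction of the binary Burnside process attached to a set `S` of coordinates. -/
def urnEigenfunction (S : Finset ι) (y : ι → Bool) : ℚ := bitChar S y / urn 1 y S

omit [Fintype ι] in
theorem urnEigenfunction_flipAt {S : Finset ι} {i : ι} (hi : i ∉ S) (y : ι → Bool) :
    urnEigenfunction S (flipAt i y) = urnEigenfunction S y := by
  have hy : ∀ j ∈ S, flipAt i y j = y j := fun j hj => flipAt_of_ne (ne_of_mem_of_not_mem hj hi) y
  rw [urnEigenfunction, urnEigenfunction, bitChar_congr hy, urn_congr 1 hy]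

/-- Consistency reduces the sum to the kernel on `S`. The denominator of the eigenfunction is the
reversing weight, so detailed balance transposes the kernel and leaves the character sum
`sum_bitChar_mul_urnKernel`. -/
theorem sum_urnKernel_mul_urnEigenfunction (S : Finset ι) (x : ι → Bool) :
    ∑ y, urnKernel Finset.univ x y * urnEigenfunction S y =
      urnEigenvalue S.card * urnEigenfunction S x := by
  rw [sum_urnKernel_mul S x _ fun i hi y => urnEigenfunction_flipAt hi y]
  have h : ∀ y, urnKernel S x y * urnEigenfunction S y =
      bitChar S y * urnKernel S y x / urn 1 x S := by
    intro y
    have h1 := (urn_pos one_pos x S).ne'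
    have h2 := (urn_pos one_pos y S).ne'
    rw [urnEigenfunction, mul_div_assoc', div_eq_div_iff h2 h1]
    linear_combination bitChar S y * urn_mul_urnKernel_comm S x y
  have hp : (1 / 2 : ℚ) ^ (Sᶜ).card * (2 ^ Fintype.card ι * (1 / 2) ^ S.card) = 1 := by
    rw [mul_left_comm, ← pow_add, Finset.card_compl_add_card, ← mul_pow]
    norm_num
  rw [Finset.sum_congr rfl fun y _ => h y, ← Finset.sum_div, sum_bitChar_mul_urnKernel,
    urnEigenfunction]
  linear_combination urnEigenvalue S.card * bitChar S x / urn 1 x S * hp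

end Kernel

/-! ### Evaluation of the eigenvalues by generating functions -/

section Eigenvalue

theorem rising_half_div (a : ℕ) : rising (1 / 2) a / rising 1 a = a.centralBinom / 4 ^ a := by
  induction a with
  | zero => simp [rising]
  | succ a ih =>
    have h := Nat.succ_mul_centralBinom_succ a
    have h' : ((a : ℚ) + 1) * (a + 1).centralBinom = 2 * (2 * a + 1) * a.centralBinom := by
      exact_mod_cast h
    have ha : (a : ℚ) + 1 ≠ 0 := by positivity
    rw [rising_succ, rising_succ, mul_div_mul_comm, ih, add_comm 1 (a : ℚ), pow_succ,
      div_mul_div_comm, div_eq_div_iff (by positivity) (by positivity)]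
    linear_combination -(4 : ℚ) ^ a * h'

theorem burnsideBeta_eq (k : ℕ) : burnsideBeta k = (k.centralBinom / 4 ^ k : ℚ) ^ 2 := by
  rw [burnsideBeta, Nat.centralBinom, div_pow, ← pow_mul, pow_mul 2 4 k,
    show (2 : ℚ) ^ 4 = 4 ^ 2 by norm_num, ← pow_mul, mul_comm k 2]
  ring

theorem burnsideBeta_pos (k : ℕ) : 0 < burnsideBeta k := by
  have := Nat.centralBinom_pos k
  rw [burnsideBeta_eq]
  positivity

theorem burnsideBeta_strictAnti : StrictAnti burnsideBeta := by
  refine strictAnti_nat_of_succ_lt fun k => ?_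
  rw [burnsideBeta_eq, burnsideBeta_eq, ← rising_half_div, ← rising_half_div, rising_succ,
    rising_succ, mul_div_mul_comm]
  have h : 0 < rising (1 / 2) k / rising 1 k :=
    div_pos (rising_pos (by norm_num) k) (rising_pos one_pos k)
  refine pow_lt_pow_left₀ (mul_lt_of_lt_one_right h ?_) (by positivity) two_ne_zero
  rw [div_lt_one (by positivity)]
  linarith

/-- The constant term of `(x + 1/x) ^ m`. -/
def evenBinom (m : ℕ) : ℕ := if 2 ∣ m then m.choose (m / 2) else 0

open Polynomial in
theorem coeff_one_add_X_sq_pow (m : ℕ) : ((1 + X ^ 2 : ℕ[X]) ^ m).coeff m = evenBinom m := by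
  have : (1 + X ^ 2 : ℕ[X]) ^ m = expand ℕ 2 ((1 + X) ^ m) := by simp
  rw [this, coeff_expand two_pos, coeff_one_add_X_pow, evenBinom, Nat.cast_id]

open Polynomial in
-- The central binomial coefficient is the constant term of $(2+x+1/x)^a$, expanded in powers of
-- $2$.
theorem centralBinom_eq_sum (a : ℕ) :
    a.centralBinom = ∑ j ∈ Finset.range (a + 1), a.choose j * 2 ^ j * evenBinom (a - j) := by
  have h : (1 + X : ℕ[X]) ^ (2 * a) = (2 * X + (1 + X ^ 2)) ^ a := by
    rw [pow_mul]
    congr 1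
    ring
  rw [Nat.centralBinom, ← Nat.cast_id ((2 * a).choose a), ← coeff_one_add_X_pow, h, add_pow,
    finsetSum_coeff]
  refine Finset.sum_congr rfl fun j hj => ?_
  have hj' : j ≤ a := Nat.lt_succ_iff.1 (Finset.mem_range.1 hj)
  have e : (2 * X : ℕ[X]) ^ j * (1 + X ^ 2) ^ (a - j) * (a.choose j : ℕ[X]) =
      C (a.choose j * 2 ^ j) * ((1 + X ^ 2) ^ (a - j) * X ^ j) := by
    rw [mul_pow]
    simp only [C_mul, C_pow, map_ofNat]
    simp
    ring
  rw [e, coeff_C_mul, coeff_mul_X_pow', if_pos hj', coeff_one_add_X_sq_pow]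

open PowerSeries in
-- The exponential generating functions of `centralBinom` and `evenBinom` satisfy $E(x)=e^{2x}G(x)$
-- with $G$ even. Hence $E(x)E(-x)=G(x)^2$: the exponentials cancel, and the alternating sum becomes
-- one with nonnegative terms.
theorem sum_alternating_centralBinom (s : ℕ) :
    ∑ a ∈ Finset.range (s + 1), (s.choose a : ℚ) *
        ((-1) ^ a * (a.centralBinom * (s - a).centralBinom)) =
      ∑ a ∈ Finset.range (s + 1), (s.choose a * (evenBinom a * evenBinom (s - a)) : ℚ) := by
  set E : ℚ⟦X⟧ := mk fun a => (a.centralBinom / a.factorial : ℚ) with hE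
  set G : ℚ⟦X⟧ := mk fun a => (evenBinom a / a.factorial : ℚ) with hG
  have hch : ∀ s a : ℕ, a ≤ s → (s.choose a : ℚ) = s.factorial / (a.factorial * (s - a).factorial) :=
    fun s a h => Nat.cast_choose ℚ h
  have key : E = rescale 2 (exp ℚ) * G := by
    ext a
    rw [hE, hG, coeff_mk, coeff_mul, Finset.Nat.sum_antidiagonal_eq_sum_range_succ_mk,
      centralBinom_eq_sum]
    push_cast
    rw [Finset.sum_div]
    refine Finset.sum_congr rfl fun j hj => ?_
    rw [hch a j (Nat.lt_succ_iff.1 (Finset.mem_range.1 hj)), coeff_rescale, coeff_exp, coeff_mk]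
    have := a.factorial_ne_zero
    simp
    field_simp
  have hG' : rescale (-1) G = G := by
    ext m
    rw [coeff_rescale, hG, coeff_mk, evenBinom]
    split_ifs with h
    · rw [(even_iff_two_dvd.2 h).neg_one_pow, one_mul]
    · simp
  have hE' : E * rescale (-1) E = G * G := by
    rw [key, map_mul, hG', rescale_rescale, mul_mul_mul_comm, exp_mul_exp_eq_exp_add]
    norm_num
  -- The factors are commuted so that the sign falls on the index `a` and not on `s - a`.
  have := congrArg (fun f => (s.factorial : ℚ) * coeff s f) ((mul_comm _ _).trans hE')
  simp only [coeff_mul, Finset.Nat.sum_antidiagonal_eq_sum_range_succ_mk, Finset.mul_sum,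
    coeff_rescale, hE, hG, coeff_mk] at this
  convert this using 1 <;> refine Finset.sum_congr rfl fun a ha => ?_ <;>
    rw [hch s a (Nat.lt_succ_iff.1 (Finset.mem_range.1 ha))] <;> field_simp

theorem sum_range_even {M : Type*} [AddCommMonoid M] (F : ℕ → M) (h : ∀ i, ¬ 2 ∣ i → F i = 0)
    (k : ℕ) : ∑ a ∈ Finset.range (2 * k + 1), F a = ∑ i ∈ Finset.range (k + 1), F (2 * i) := by
  induction k with
  | zero => simp
  | succ k ih =>
    rw [Finset.sum_range_succ _ (k + 1), ← ih, Nat.mul_succ, Finset.sum_range_succ,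
      Finset.sum_range_succ _ (2 * k + 1), h (2 * k + 1) (by omega), add_zero]

theorem urnEigenvalue_eq (s : ℕ) : urnEigenvalue s = (∑ a ∈ Finset.range (s + 1),
    (s.choose a * (evenBinom a * evenBinom (s - a)) : ℚ)) / 4 ^ s := by
  rw [← sum_alternating_centralBinom, urnEigenvalue, Finset.sum_div]
  refine Finset.sum_congr rfl fun a ha => ?_
  have h : (4 : ℚ) ^ s = 4 ^ a * 4 ^ (s - a) := by
    rw [← pow_add, Nat.add_sub_cancel' (Nat.lt_succ_iff.1 (Finset.mem_range.1 ha))]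
  rw [rising_half_div, rising_half_div, h]
  field_simp

theorem urnEigenvalue_two_mul (k : ℕ) : urnEigenvalue (2 * k) = burnsideBeta k := by
  -- With $j=k-i$, both sides equal $(2k)!/(i!\,j!)^2$; the squares of the binomial coefficients
  -- then sum to another central binomial coefficient.
  have h : ∀ i ∈ Finset.range (k + 1), ((2 * k).choose (2 * i) *
      (evenBinom (2 * i) * evenBinom (2 * k - 2 * i)) : ℚ) =
        k.centralBinom * ((k.choose i ^ 2 : ℕ) : ℚ) := by
    intro i hi
    have hi' : i ≤ k := Nat.lt_succ_iff.1 (Finset.mem_range.1 hi)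
    obtain ⟨j, rfl⟩ := Nat.exists_eq_add_of_le hi'
    rw [show 2 * (i + j) - 2 * i = 2 * j by omega, evenBinom, evenBinom, if_pos ⟨i, rfl⟩,
      if_pos ⟨j, rfl⟩, Nat.mul_div_cancel_left _ two_pos, Nat.mul_div_cancel_left _ two_pos,
      Nat.centralBinom, Nat.cast_pow, Nat.cast_choose ℚ (show 2 * i ≤ 2 * (i + j) by omega),
      Nat.cast_choose ℚ (show i ≤ 2 * i by omega), Nat.cast_choose ℚ (show j ≤ 2 * j by omega),
      Nat.cast_choose ℚ (show i ≤ i + j by omega),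
      Nat.cast_choose ℚ (show i + j ≤ 2 * (i + j) by omega),
      show 2 * (i + j) - 2 * i = 2 * j by omega, show 2 * i - i = i by omega,
      show 2 * j - j = j by omega, show i + j - i = j by omega,
      show 2 * (i + j) - (i + j) = i + j by omega]
    field_simp
  rw [urnEigenvalue_eq, sum_range_even _ fun i hi => by simp [evenBinom, hi],
    Finset.sum_congr rfl h, ← Finset.mul_sum, ← Nat.cast_sum, Nat.sum_range_choose_sq,
    burnsideBeta_eq, ← Nat.centralBinom, div_pow, ← pow_mul, mul_comm k 2, sq]

theorem urnEigenvalue_odd (k : ℕ) : urnEigenvalue (2 * k + 1) = 0 := by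
  rw [urnEigenvalue_eq, Finset.sum_eq_zero, zero_div]
  intro a ha
  have ha' : a ≤ 2 * k + 1 := Nat.lt_succ_iff.1 (Finset.mem_range.1 ha)
  by_cases h : 2 ∣ a
  · have : ¬ 2 ∣ 2 * k + 1 - a := by omega
    simp [evenBinom, this]
  · simp [evenBinom, h]

/-- Monotonicity of $\beta$ separates the degrees, so no two even degrees share an eigenvalue. -/
theorem urnEigenvalue_eq_burnsideBeta_iff (s k : ℕ) :
    urnEigenvalue s = burnsideBeta k ↔ s = 2 * k := by
  refine ⟨fun h => ?_, fun h => h ▸ urnEigenvalue_two_mul k⟩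
  obtain ⟨j, rfl | rfl⟩ := Nat.even_or_odd' s
  · rw [urnEigenvalue_two_mul] at h
    rw [burnsideBeta_strictAnti.injective h]
  · rw [urnEigenvalue_odd] at h
    exact absurd h (burnsideBeta_pos k).ne

end Eigenvalue

/-! ### The equivariant eigenbasis -/

section Eigenbasis

/-- The set of coordinates at which the tuple `x` is one. -/
def ones {n : ℕ} (x : BinTuple n) : Finset (Fin n) := Finset.univ.filter fun i => x i = true

@[simp] theorem mem_ones {n : ℕ} {x : BinTuple n} {i : Fin n} : i ∈ ones x ↔ x i = true := by
  simp [ones]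

theorem ones_injective {n : ℕ} : Function.Injective (ones (n := n)) := by
  intro x y h
  funext i
  have : i ∈ ones x ↔ i ∈ ones y := by rw [h]
  rw [mem_ones, mem_ones] at this
  exact Bool.eq_iff_iff.2 this

theorem map_ones_comp {n : ℕ} (x : BinTuple n) (σ : Equiv.Perm (Fin n)) :
    (ones (x ∘ σ)).map σ.toEmbedding = ones x := by
  ext i
  simp [Finset.mem_map_equiv]

theorem card_ones_comp {n : ℕ} (x : BinTuple n) (σ : Equiv.Perm (Fin n)) :
    (ones (x ∘ σ)).card = (ones x).card := by
  rw [← map_ones_comp x σ, Finset.card_map]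

theorem urnEigenfunction_comp {n : ℕ} (x y : BinTuple n) (σ : Equiv.Perm (Fin n)) :
    urnEigenfunction (ones (x ∘ σ)) (y ∘ σ) = urnEigenfunction (ones x) y := by
  rw [← map_ones_comp x σ, urnEigenfunction, urnEigenfunction, urn_map, bitChar, bitChar,
    Finset.prod_map]
  rfl

theorem sum_bitChar_mul_urnEigenfunction_of_not_subset {n : ℕ} {S T : Finset (Fin n)}
    (h : ¬ S ⊆ T) : ∑ y, bitChar S y * urnEigenfunction T y = 0 := by
  obtain ⟨i, hS, hT⟩ := Finset.not_subset.1 h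
  refine sum_flipAt_neg (i := i) fun y => ?_
  rw [bitChar_flipAt hS, urnEigenfunction_flipAt hT, neg_mul]

theorem sum_bitChar_mul_urnEigenfunction_self {n : ℕ} (S : Finset (Fin n)) :
    0 < ∑ y, bitChar S y * urnEigenfunction S y := by
  refine Finset.sum_pos (fun y _ => ?_) Finset.univ_nonempty
  rw [urnEigenfunction, mul_div_assoc', bitChar_mul_self]
  exact div_pos one_pos (urn_pos one_pos y S)

/-- The linear map that takes the indicator function of `x` to the eigenfunction attached to the
set of ones of `x`. -/
noncomputable def eigenMap (n : ℕ) : (BinTuple n → ℂ) →ₗ[ℂ] (BinTuple n → ℂ) :=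
  Matrix.toLin' (Matrix.of fun y x => (urnEigenfunction (ones x) y : ℂ))

theorem eigenMap_apply (n : ℕ) (g : BinTuple n → ℂ) (y : BinTuple n) :
    eigenMap n g y = ∑ x, (urnEigenfunction (ones x) y : ℂ) * g x := by
  simp [eigenMap, Matrix.mulVec, dotProduct]

theorem burnsideOp_apply (n : ℕ) (g : BinTuple n → ℂ) (x : BinTuple n) :
    burnsideOp n g x = ∑ y, (burnsideMatrix n x y : ℂ) * g y := by
  simp [burnsideOp, Matrix.mulVec, dotProduct]

theorem eigenMap_comm (n : ℕ) (σ : Equiv.Perm (Fin n)) (f : BinTuple n → ℂ) :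
    eigenMap n (binRep n σ f) = binRep n σ (eigenMap n f) := by
  funext x
  have h2 : ∀ (g : BinTuple n → ℂ) (x : BinTuple n), binRep n σ g x = g (x ∘ σ) :=
    fun _ _ => rfl
  rw [h2, eigenMap_apply, eigenMap_apply]
  refine Fintype.sum_equiv (Equiv.arrowCongr σ.symm (Equiv.refl Bool)) _ _ (fun y => ?_)
  have h3 : (Equiv.arrowCongr σ.symm (Equiv.refl Bool)) y = y ∘ σ := by
    funext i
    simp
  rw [h3, urnEigenfunction_comp, h2]

theorem burnsideOp_eigenMap (n : ℕ) (g : BinTuple n → ℂ) :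
    burnsideOp n (eigenMap n g) =
      eigenMap n fun x => (urnEigenvalue (ones x).card : ℂ) * g x := by
  funext x
  simp only [burnsideOp_apply, eigenMap_apply, Finset.mul_sum]
  rw [Finset.sum_comm]
  refine Finset.sum_congr rfl fun z _ => ?_
  have h := sum_urnKernel_mul_urnEigenfunction (ones z) x
  simp only [← burnsideMatrix_eq_urnKernel] at h
  have h' := congrArg (Rat.cast : ℚ → ℂ) h
  push_cast at h'
  simp only [← mul_assoc, ← Finset.sum_mul, h']
  ring

/-- The pairing of the character of `S` with the eigenfunction of `T` is triangular for inclusion,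
with positive diagonal. Testing a relation against the character of a set of maximal size in its
support isolates one coefficient. -/
theorem eigenMap_injective (n : ℕ) : Function.Injective (eigenMap n) := by
  refine (injective_iff_map_eq_zero _).2 fun g hg => ?_
  by_contra hne
  obtain ⟨x₀, hx₀⟩ := Function.ne_iff.1 hne
  obtain ⟨x, hx, hmax⟩ := (Finset.univ.filter fun x => g x ≠ 0).exists_max_image
    (fun x => (ones x).card) ⟨x₀, by simpa using hx₀⟩
  have hgx : g x ≠ 0 := by simpa using hx
  have hz : ∑ y, (bitChar (ones x) y : ℂ) * eigenMap n g y = 0 := by simp [hg]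
  simp only [eigenMap_apply, Finset.mul_sum] at hz
  rw [Finset.sum_comm] at hz
  simp only [← mul_assoc, ← Finset.sum_mul, ← Rat.cast_mul, ← Rat.cast_sum] at hz
  rw [Finset.sum_eq_single x] at hz
  · rcases mul_eq_zero.1 hz with h | h
    · exact (sum_bitChar_mul_urnEigenfunction_self (ones x)).ne' (by exact_mod_cast h)
    · exact hgx h
  · intro z _ hzx
    by_cases hgz : g z = 0
    · rw [hgz, mul_zero]
    · rw [sum_bitChar_mul_urnEigenfunction_of_not_subset, Rat.cast_zero, zero_mul]
      intro hsub
      exact hzx (ones_injective (Finset.eq_of_subset_of_card_le hsub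
        (hmax z (by simpa using hgz)))).symm
  · simp

end Eigenbasis

/-! ### The space of functions as a module over the group algebra -/

section Module

variable {n : ℕ}

/-- The values of an element of `L(C_2^n)`. -/
noncomputable def BinModule.toFun (z : BinModule n) : BinTuple n → ℂ := (binRep n).asModuleEquiv z

/-- The element of `L(C_2^n)` with given values. -/
noncomputable def BinModule.ofFun (f : BinTuple n → ℂ) : BinModule n :=
  (binRep n).asModuleEquiv.symm f

namespace BinModule

@[simp] theorem toFun_ofFun (f : BinTuple n → ℂ) : (ofFun f).toFun = f :=
  (binRep n).asModuleEquiv.apply_symm_apply f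

@[simp] theorem toFun_add (z w : BinModule n) : (z + w).toFun = z.toFun + w.toFun :=
  map_add (binRep n).asModuleEquiv z w

@[simp] theorem toFun_smul (c : ℂ) (z : BinModule n) : (c • z).toFun = c • z.toFun :=
  map_smul (binRep n).asModuleEquiv c z

@[simp] theorem toFun_zero : (0 : BinModule n).toFun = 0 := map_zero (binRep n).asModuleEquiv

@[ext] theorem ext {z w : BinModule n} (h : ∀ x, z.toFun x = w.toFun x) : z = w :=
  (binRep n).asModuleEquiv.injective (funext h)

theorem single_smul (σ : Equiv.Perm (Fin n)) (c : ℂ) (z : BinModule n) (x : BinTuple n) :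
    ((MonoidAlgebra.single σ c : ℂ[Equiv.Perm (Fin n)]) • z).toFun x = c * z.toFun (x ∘ σ) := by
  rw [Representation.single_smul]
  rfl

theorem toFun_sum {ι : Type*} (s : Finset ι) (f : ι → BinModule n) (x : BinTuple n) :
    (∑ i ∈ s, f i).toFun x = ∑ i ∈ s, (f i).toFun x := by
  have := map_sum (binRep n).asModuleEquiv f s
  exact (congrFun this x).trans (Finset.sum_apply _ _ _)

theorem smul_apply (a : ℂ[Equiv.Perm (Fin n)]) (z : BinModule n) (x : BinTuple n) :
    (a • z).toFun x = ∑ σ, a.coeff σ * z.toFun (x ∘ σ) := by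
  induction a using MonoidAlgebra.induction_linear with
  | zero => simp
  | add a b ha hb =>
    rw [add_smul, toFun_add, Pi.add_apply, ha, hb, ← Finset.sum_add_distrib]
    simp only [MonoidAlgebra.coeff_add, Finsupp.add_apply, add_mul]
  | single σ c =>
    rw [single_smul]
    simp [Finsupp.single_apply]

theorem burnsideK_toFun (z : BinModule n) : (burnsideK n z).toFun = burnsideOp n z.toFun := rfl

/-- The equivariant automorphism of `L(C_2^n)` that takes indicator functions to eigenfunctions
of the Burnside operator. -/
noncomputable def eigenEquiv (n : ℕ) : BinModule n ≃ₗ[ℂ[Equiv.Perm (Fin n)]] BinModule n :=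
  LinearEquiv.ofBijective
    (MonoidAlgebra.equivariantOfLinearOfComm
      (((binRep n).asModuleEquiv.symm.toLinearMap ∘ₗ eigenMap n) ∘ₗ
        (binRep n).asModuleEquiv.toLinearMap) (by
      intro σ v
      simp only [Representation.single_smul, one_smul]
      exact eigenMap_comm n σ v))
    ⟨eigenMap_injective n, LinearMap.surjective_of_injective (eigenMap_injective n)⟩

theorem eigenEquiv_toFun (z : BinModule n) : (eigenEquiv n z).toFun = eigenMap n z.toFun := rfl

theorem burnsideK_eigenEquiv (z : BinModule n) : burnsideK n (eigenEquiv n z) =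
    eigenEquiv n (ofFun fun x => (urnEigenvalue (ones x).card : ℂ) * z.toFun x) := by
  ext x
  rw [burnsideK_toFun, eigenEquiv_toFun, burnsideOp_eigenMap, eigenEquiv_toFun, toFun_ofFun]

theorem eigenEquiv_symm_burnsideK (z : BinModule n) (x : BinTuple n) :
    ((eigenEquiv n).symm (burnsideK n z)).toFun x =
      (urnEigenvalue (ones x).card : ℂ) * ((eigenEquiv n).symm z).toFun x := by
  obtain ⟨w, rfl⟩ := (eigenEquiv n).surjective z
  rw [burnsideK_eigenEquiv, LinearEquiv.symm_apply_apply, LinearEquiv.symm_apply_apply,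
    toFun_ofFun]

end BinModule

end Module

/-! ### Equivariant maps out of a Specht module: uniqueness and support -/

section Tableau

variable {n : ℕ} {μ : YoungDiagram} (t : Fin n ≃ μ.cells)

/-- The permutation `σ` preserves the rows of the tableau `t`. -/
abbrev PreservesRows (σ : Equiv.Perm (Fin n)) : Prop := ∀ i, (t (σ i)).1.1 = (t i).1.1

/-- The permutation `σ` preserves the columns of the tableau `t`. -/
abbrev PreservesColumns (σ : Equiv.Perm (Fin n)) : Prop := ∀ i, (t (σ i)).1.2 = (t i).1.2

theorem card_filter_tableau (P : ℕ × ℕ → Prop) [DecidablePred P] :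
    (Finset.univ.filter fun i => P (t i).1).card = (μ.cells.filter P).card := by
  refine Finset.card_bij (fun i _ => (t i).1) (fun i hi => ?_) (fun i _ j _ h => ?_)
    fun q hq => ?_
  · exact Finset.mem_filter.2 ⟨(t i).2, (Finset.mem_filter.1 hi).2⟩
  · exact t.injective (Subtype.ext h)
  · rw [Finset.mem_filter] at hq
    exact ⟨t.symm ⟨q, hq.1⟩, by simpa using hq.2, by simp⟩

theorem card_row (r : ℕ) : (Finset.univ.filter fun i => (t i).1.1 = r).card = μ.rowLen r := by
  rw [YoungDiagram.rowLen_eq_card]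
  exact card_filter_tableau t fun q => q.1 = r

theorem eq_of_row_col {i j : Fin n} (hr : (t i).1.1 = (t j).1.1) (hc : (t i).1.2 = (t j).1.2) :
    i = j :=
  t.injective (Subtype.ext (Prod.ext hr hc))

theorem exists_entry {a b : ℕ} (h : (a, b) ∈ μ) : ∃ i, (t i).1 = (a, b) :=
  ⟨t.symm ⟨(a, b), h⟩, by simp⟩

theorem row_le_one (h2 : μ.rowLen 2 = 0) (i : Fin n) : (t i).1.1 ≤ 1 := by
  by_contra h
  have h1 : (t i).1.2 < μ.rowLen (t i).1.1 :=
    YoungDiagram.mem_iff_lt_rowLen.1 ((YoungDiagram.mem_cells _).1 (t i).2)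
  have h3 : μ.rowLen (t i).1.1 ≤ μ.rowLen 2 := μ.rowLen_anti 2 (t i).1.1 (by omega)
  exact Nat.not_lt_zero _ (h1.trans_le (h3.trans h2.le))

include t in
theorem isTwoRow_of_rowLen_two (h2 : μ.rowLen 2 = 0) : IsTwoRow μ n (μ.rowLen 1) := by
  have h : μ.rowLen 0 + μ.rowLen 1 = n := by
    rw [← card_row t 0, ← card_row t 1, ← Finset.card_union_of_disjoint
      (Finset.disjoint_filter.2 fun i _ h => by omega), ← Finset.filter_or,
      Finset.filter_true_of_mem fun i _ => by have := row_le_one t h2 i; omega,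
      Finset.card_univ, Fintype.card_fin]
  have := μ.rowLen_anti 0 1 zero_le_one
  exact ⟨by omega, by omega, rfl, h2⟩

/-- In a tableau with at most two rows, the other entry of the same column if there is one. -/
theorem exists_partner (h2 : μ.rowLen 2 = 0) : ∃ p : Fin n → Fin n,
    (∀ i, (t (p i)).1.2 = (t i).1.2) ∧ (∀ i, p (p i) = i) ∧
    (∀ i, (t i).1.1 = 1 → p i ≠ i) ∧
    (∀ i j, (t j).1.2 = (t i).1.2 → j = i ∨ j = p i) := by
  classical
  let p : Fin n → Fin n := fun i =>
    if h : (1 - (t i).1.1, (t i).1.2) ∈ μ then t.symm ⟨_, h⟩ else i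
  have hp : ∀ i, (1 - (t i).1.1, (t i).1.2) ∈ μ → (t (p i)).1 = (1 - (t i).1.1, (t i).1.2) :=
    fun i h => by simp [p, h]
  have hp' : ∀ i, (1 - (t i).1.1, (t i).1.2) ∉ μ → p i = i := fun i h => by simp [p, h]
  have hcol : ∀ i, (t (p i)).1.2 = (t i).1.2 := by
    intro i
    by_cases h : (1 - (t i).1.1, (t i).1.2) ∈ μ
    · rw [hp i h]
    · rw [hp' i h]
  refine ⟨p, hcol, fun i => ?_, fun i h1 he => ?_, fun i j hj => ?_⟩
  · by_cases h : (1 - (t i).1.1, (t i).1.2) ∈ μ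
    · have hr := row_le_one t h2 i
      have e : (1 - (t (p i)).1.1, (t (p i)).1.2) = (t i).1 := by
        rw [hp i h]
        ext <;> simp; omega
      have hm : (1 - (t (p i)).1.1, (t (p i)).1.2) ∈ μ := by rw [e]; exact (t i).2
      exact t.injective (Subtype.ext ((hp _ hm).trans e))
    · rw [hp' i h, hp' i h]
  · have hm : (1 - (t i).1.1, (t i).1.2) ∈ μ :=
      μ.up_left_mem (by omega) le_rfl ((YoungDiagram.mem_cells _).1 (t i).2)
    have := congrArg Prod.fst (hp i hm)
    rw [he] at this
    simp [h1] at this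
  · by_cases hr : (t j).1.1 = (t i).1.1
    · exact Or.inl (eq_of_row_col t hr hj)
    · have h := row_le_one t h2 i
      have h' := row_le_one t h2 j
      have e : (1 - (t i).1.1, (t i).1.2) = (t j).1 := by
        ext
        · simp; omega
        · simp [hj]
      have hm : (1 - (t i).1.1, (t i).1.2) ∈ μ := by rw [e]; exact (t j).2
      exact Or.inr (t.injective (Subtype.ext ((hp i hm).trans e).symm))

/-- The sign of a permutation as a complex number. -/
noncomputable abbrev csign (σ : Equiv.Perm (Fin n)) : ℂ := ((Equiv.Perm.sign σ : ℤˣ) : ℤ)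

theorem single_mul_rowSum {π : Equiv.Perm (Fin n)} (hπ : PreservesRows t π) :
    MonoidAlgebra.single π 1 * rowSum t = rowSum t := by
  simp only [rowSum, Finset.mul_sum, MonoidAlgebra.single_mul_single, one_mul]
  refine Finset.sum_equiv (Equiv.mulLeft π) (fun σ => ?_) fun σ _ => rfl
  simp [hπ _]

theorem rowSum_mul_single {π : Equiv.Perm (Fin n)} (hπ : PreservesRows t π) :
    rowSum t * MonoidAlgebra.single π 1 = rowSum t := by
  simp only [rowSum, Finset.sum_mul, MonoidAlgebra.single_mul_single, one_mul]
  refine Finset.sum_equiv (Equiv.mulRight π) (fun σ => ?_) fun σ _ => rfl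
  simp only [Finset.mem_filter, Finset.mem_univ, true_and, Equiv.coe_mulRight,
    Equiv.Perm.mul_apply]
  refine ⟨fun h i => (h _).trans (hπ i), fun h i => ?_⟩
  have h1 := h (π.symm i)
  have h2 := hπ (π.symm i)
  simp only [Equiv.apply_symm_apply] at h1 h2
  rw [h1, h2]

theorem single_mul_signedColumnSum {σ : Equiv.Perm (Fin n)} (hσ : PreservesColumns t σ) :
    MonoidAlgebra.single σ 1 * signedColumnSum t = csign σ • signedColumnSum t := by
  have hs : csign σ * csign σ = 1 := by
    rw [← Int.cast_mul, ← Units.val_mul, Int.units_mul_self]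
    simp
  simp only [signedColumnSum, Finset.mul_sum, MonoidAlgebra.single_mul_single, one_mul,
    Finset.smul_sum, MonoidAlgebra.smul_single, smul_eq_mul]
  refine Finset.sum_equiv (Equiv.mulLeft σ) (fun τ => ?_) fun τ _ => ?_
  · simp [hσ _]
  · rw [Equiv.coe_mulLeft, Equiv.Perm.sign_mul, Units.val_mul, Int.cast_mul, ← mul_assoc, hs,
      one_mul]

theorem single_mul_signedColumnSum_comm {π : Equiv.Perm (Fin n)}
    (hπ : ∀ σ, PreservesColumns t σ → Commute π σ) :
    MonoidAlgebra.single π 1 * signedColumnSum t =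
      signedColumnSum t * MonoidAlgebra.single π 1 := by
  simp only [signedColumnSum, Finset.mul_sum, Finset.sum_mul, MonoidAlgebra.single_mul_single,
    one_mul, mul_one]
  refine Finset.sum_congr rfl fun σ hσ => ?_
  rw [(hπ σ (Finset.mem_filter.1 hσ).2).eq]

/-- The generator of the Specht module. -/
noncomputable def spechtGen : Specht t :=
  ⟨signedColumnSum t * rowSum t, Submodule.mem_span_singleton_self _⟩

theorem exists_smul_spechtGen (s : Specht t) : ∃ a : ℂ[Equiv.Perm (Fin n)], s = a • spechtGen t := by
  obtain ⟨a, ha⟩ := Submodule.mem_span_singleton.1 s.2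
  exact ⟨a, Subtype.ext ha.symm⟩

theorem specht_hom_ext {M : Type*} [AddCommGroup M] [Module ℂ[Equiv.Perm (Fin n)] M]
    {φ ψ : Specht t →ₗ[ℂ[Equiv.Perm (Fin n)]] M} (h : φ (spechtGen t) = ψ (spechtGen t)) :
    φ = ψ := by
  ext s
  obtain ⟨a, rfl⟩ := exists_smul_spechtGen t s
  rw [map_smul, map_smul, h]

theorem hom_spechtGen_column (φ : SpechtHom t) {σ : Equiv.Perm (Fin n)}
    (hσ : PreservesColumns t σ) (x : BinTuple n) :
    (φ (spechtGen t)).toFun (x ∘ σ) = csign σ * (φ (spechtGen t)).toFun x := by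
  have h : (MonoidAlgebra.single σ 1 : ℂ[Equiv.Perm (Fin n)]) • spechtGen t =
      csign σ • spechtGen t := by
    refine Subtype.ext ?_
    change MonoidAlgebra.single σ 1 * (signedColumnSum t * rowSum t) =
      csign σ • (signedColumnSum t * rowSum t)
    rw [← mul_assoc, single_mul_signedColumnSum t hσ, smul_mul_assoc]
  have h' := congrArg (fun s => (φ s).toFun x) h
  simp only [map_smul, LinearMap.map_smul_of_tower, BinModule.single_smul, one_mul,
    BinModule.toFun_smul] at h'
  exact h'

/-- A row permutation fixes `rowSum t` from the left, but it has to pass `signedColumnSum t` first;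
this is why it is required to commute with the column group. -/
theorem hom_spechtGen_row (φ : SpechtHom t) {π : Equiv.Perm (Fin n)} (hr : PreservesRows t π)
    (hc : ∀ σ, PreservesColumns t σ → Commute π σ) (x : BinTuple n) :
    (φ (spechtGen t)).toFun (x ∘ π) = (φ (spechtGen t)).toFun x := by
  have h : (MonoidAlgebra.single π 1 : ℂ[Equiv.Perm (Fin n)]) • spechtGen t = spechtGen t := by
    refine Subtype.ext ?_
    change MonoidAlgebra.single π 1 * (signedColumnSum t * rowSum t) =
      signedColumnSum t * rowSum t
    rw [← mul_assoc, single_mul_signedColumnSum_comm t hc, mul_assoc, single_mul_rowSum t hr]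
  have h' := congrArg (fun s => (φ s).toFun x) h
  simp only [map_smul, BinModule.single_smul, one_mul] at h'
  exact h'

/-- An equivariant map on the Specht module vanishes at tuples with equal entries in a column. -/
theorem hom_spechtGen_eq_zero (φ : SpechtHom t) {i j : Fin n} (hij : i ≠ j)
    (hc : (t i).1.2 = (t j).1.2) {x : BinTuple n} (hx : x i = x j) :
    (φ (spechtGen t)).toFun x = 0 := by
  have hσ : PreservesColumns t (Equiv.swap i j) := by
    intro k
    rcases eq_or_ne k i with rfl | hi
    · rw [Equiv.swap_apply_left, hc]
    rcases eq_or_ne k j with rfl | hj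
    · rw [Equiv.swap_apply_right, hc]
    rw [Equiv.swap_apply_of_ne_of_ne hi hj]
  have hxs : x ∘ Equiv.swap i j = x := by
    funext k
    rcases eq_or_ne k i with rfl | hi
    · simp [hx]
    rcases eq_or_ne k j with rfl | hj
    · simp [hx]
    simp [Equiv.swap_apply_of_ne_of_ne hi hj]
  have h := hom_spechtGen_column t φ hσ x
  rw [hxs, csign, Equiv.Perm.sign_swap hij] at h
  simp at h
  linear_combination h / 2

/-- Pigeonhole: a column with three cells carries a repeated bit. -/
theorem spechtHom_eq_zero (h2 : μ.rowLen 2 ≠ 0) (φ : SpechtHom t) : φ = 0 := by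
  refine specht_hom_ext t (BinModule.ext fun x => ?_)
  have hm : (2, 0) ∈ μ := YoungDiagram.mem_iff_lt_rowLen.2 (Nat.pos_of_ne_zero h2)
  obtain ⟨a, ha⟩ := exists_entry t hm
  obtain ⟨b, hb⟩ := exists_entry t (μ.up_left_mem one_le_two le_rfl hm)
  obtain ⟨c, hc⟩ := exists_entry t (μ.up_left_mem zero_le_two le_rfl hm)
  have hab : a ≠ b := by rintro rfl; simp [ha] at hb
  have hac : a ≠ c := by rintro rfl; simp [ha] at hc
  have hbc : b ≠ c := by rintro rfl; simp [hb] at hc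
  rw [LinearMap.zero_apply, BinModule.toFun_zero]
  by_cases h1 : x a = x b
  · exact hom_spechtGen_eq_zero t φ hab (by rw [ha, hb]) h1
  by_cases h3 : x a = x c
  · exact hom_spechtGen_eq_zero t φ hac (by rw [ha, hc]) h3
  · refine hom_spechtGen_eq_zero t φ hbc (by rw [hb, hc]) ?_
    revert h1 h3
    cases x a <;> cases x b <;> cases x c <;> simp

/-- Two tuples with the same number of entries of each kind differ by a permutation. -/
theorem exists_perm_comp_eq {κ : Type*} [DecidableEq κ] {f g : Fin n → κ}
    (h : ∀ q, (Finset.univ.filter (f · = q)).card = (Finset.univ.filter (g · = q)).card) :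
    ∃ π : Equiv.Perm (Fin n), f ∘ π = g := by
  have e : ∀ q, Nonempty ({a // g a = q} ≃ {a // f a = q}) := fun q =>
    ⟨Fintype.equivOfCardEq (by rw [Fintype.card_subtype, Fintype.card_subtype, h])⟩
  exact ⟨Equiv.ofFiberEquiv fun q => (e q).some, funext fun i => Equiv.ofFiberEquiv_map _ i⟩

/-- If `x` and `y` have as many ones and differ only at fixed points of `p`, then they differ by a
permutation of the fixed points of `p`. -/
theorem exists_perm_fixedPoints {p : Fin n → Fin n} {x y : BinTuple n}
    (hxy : ∀ i, p i ≠ i → x i = y i) (hcard : (ones x).card = (ones y).card) :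
    ∃ π : Equiv.Perm (Fin n), (∀ i, p i ≠ i → π i = i) ∧ x ∘ π = y := by
  -- Each non-fixed point of `p` gets a colour of its own, so a permutation matching the colourings
  -- must fix it.
  let f : BinTuple n → Fin n → Bool ⊕ Fin n := fun x i => if p i = i then .inl (x i) else .inr i
  have hsplit : ∀ x : BinTuple n, (ones x).card =
      (Finset.univ.filter fun i => p i = i ∧ x i = true).card +
        (Finset.univ.filter fun i => p i ≠ i ∧ x i = true).card := by
    intro x
    rw [← Finset.card_filter_add_card_filter_not (s := ones x) (p := fun i => p i = i), ones,
      Finset.filter_filter, Finset.filter_filter]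
    simp only [and_comm, ne_eq]
  have hne : (Finset.univ.filter fun i => p i ≠ i ∧ x i = true) =
      Finset.univ.filter fun i => p i ≠ i ∧ y i = true :=
    Finset.filter_congr fun i _ => and_congr_right fun h => by rw [hxy i h]
  have htrue : (Finset.univ.filter fun i => p i = i ∧ x i = true).card =
      (Finset.univ.filter fun i => p i = i ∧ y i = true).card := by
    have h1 := hsplit x
    have h2 := hsplit y
    rw [hne] at h1
    omega
  have hall : ∀ x : BinTuple n, (Finset.univ.filter fun i => p i = i).card =
      (Finset.univ.filter fun i => p i = i ∧ x i = true).card +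
        (Finset.univ.filter fun i => p i = i ∧ x i = false).card := by
    intro x
    rw [← Finset.card_filter_add_card_filter_not (s := Finset.univ.filter fun i => p i = i)
      (p := fun i => x i = true), Finset.filter_filter, Finset.filter_filter]
    simp
  have hfalse : (Finset.univ.filter fun i => p i = i ∧ x i = false).card =
      (Finset.univ.filter fun i => p i = i ∧ y i = false).card := by
    have h1 := hall x
    have h2 := hall y
    omega
  have hinl : ∀ (x : BinTuple n) b, (Finset.univ.filter fun i => f x i = .inl b) =
      Finset.univ.filter fun i => p i = i ∧ x i = b := by
    intro x b
    refine Finset.filter_congr fun i _ => ?_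
    by_cases h : p i = i <;> simp [f, h]
  have hinr : ∀ (x : BinTuple n) j, (Finset.univ.filter fun i => f x i = .inr j) =
      Finset.univ.filter fun i => p i ≠ i ∧ i = j := by
    intro x b
    refine Finset.filter_congr fun i _ => ?_
    by_cases h : p i = i <;> simp [f, h]
  obtain ⟨π, hπ⟩ := exists_perm_comp_eq (f := f x) (g := f y) (by
    rintro ((_ | _) | j)
    · rw [hinl, hinl, hfalse]
    · rw [hinl, hinl, htrue]
    · rw [hinr, hinr])
  have hfix : ∀ i, p i ≠ i → π i = i := by
    intro i hi
    have := congrFun hπ i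
    simp only [f, Function.comp_apply, if_neg hi] at this
    split_ifs at this
    exact Sum.inr_injective this
  refine ⟨π, hfix, funext fun i => ?_⟩
  by_cases hi : p i = i
  · have := congrFun hπ i
    simp only [f, Function.comp_apply, if_pos hi] at this
    split_ifs at this
    exact Sum.inl_injective this
  · rw [Function.comp_apply, hfix i hi, hxy i hi]

/-- For each number of ones, the values of equivariant maps at the generator of a two-row Specht
module are proportional. -/
theorem hom_spechtGen_mul_comm (h2 : μ.rowLen 2 = 0) (φ ψ : SpechtHom t) {x y : BinTuple n}
    (hxy : (ones x).card = (ones y).card) :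
    (φ (spechtGen t)).toFun x * (ψ (spechtGen t)).toFun y =
      (φ (spechtGen t)).toFun y * (ψ (spechtGen t)).toFun x := by
  obtain ⟨p, hcol, hpp, hrow, hor⟩ := exists_partner t h2
  by_cases hx : ∃ i, p i ≠ i ∧ x (p i) = x i
  · obtain ⟨i, hi, he⟩ := hx
    rw [hom_spechtGen_eq_zero t φ hi (hcol i) he, hom_spechtGen_eq_zero t ψ hi (hcol i) he]
    simp
  by_cases hy : ∃ i, p i ≠ i ∧ y (p i) = y i
  · obtain ⟨i, hi, he⟩ := hy
    rw [hom_spechtGen_eq_zero t φ hi (hcol i) he, hom_spechtGen_eq_zero t ψ hi (hcol i) he]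
    simp
  push Not at hx hy
  -- Both tuples take opposite values in every column with two cells, so they agree or disagree on
  -- such a column as a whole. Swapping the columns of disagreement makes them agree off the fixed
  -- points of `p`.
  let c₀ : Fin n → Fin n := fun i => if x i = y i then i else p i
  have hc₀ : Function.Involutive c₀ := by
    intro i
    by_cases h : x i = y i
    · simp [c₀, h]
    · by_cases hi : p i = i
      · simp [c₀, h, hi]
      · have h' : x (p i) ≠ y (p i) := by
          rw [Bool.eq_not.2 (hx i hi), Bool.eq_not.2 (hy i hi)]
          simpa using h
        simp [c₀, h, h', hpp]
  let c : Equiv.Perm (Fin n) := hc₀.toPerm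
  have hc : PreservesColumns t c := by
    intro i
    change (t (c₀ i)).1.2 = _
    simp only [c₀]
    split_ifs
    · rfl
    · exact hcol i
  have hagree : ∀ i, p i ≠ i → (x ∘ c) i = y i := by
    intro i hi
    change x (c₀ i) = y i
    simp only [c₀]
    split_ifs with h
    · exact h
    · rw [Bool.eq_not.2 (hx i hi)]
      exact (Bool.eq_not.2 fun h' => h h'.symm).symm
  obtain ⟨π, hπ, hπy⟩ := exists_perm_fixedPoints hagree ((card_ones_comp x c).trans hxy)
  have hπfix : ∀ i, p i = i → p (π i) = π i := by
    intro i hi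
    by_contra h
    have h1 : π i = i := π.injective (hπ _ h)
    rw [h1] at h
    exact h hi
  -- Entries of the second row have partners, so all fixed points of `p` lie in the first row.
  have hrows : PreservesRows t π := by
    intro i
    by_cases hi : p i = i
    · have h1 := row_le_one t h2 i
      have h1' := row_le_one t h2 (π i)
      have h3 : (t i).1.1 ≠ 1 := fun h => hrow i h hi
      have h4 : (t (π i)).1.1 ≠ 1 := fun h => hrow _ h (hπfix i hi)
      omega
    · rw [hπ i hi]
  have hcomm : ∀ σ, PreservesColumns t σ → Commute π σ := by
    intro σ hσ
    refine Equiv.Perm.Disjoint.commute fun i => ?_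
    by_cases hi : p i = i
    · right
      rcases hor i (σ i) (hσ i) with h | h
      · exact h
      · rw [h, hi]
    · exact Or.inl (hπ i hi)
  have key : ∀ φ : SpechtHom t,
      (φ (spechtGen t)).toFun y = csign c * (φ (spechtGen t)).toFun x := by
    intro φ
    rw [← hπy, hom_spechtGen_row t φ hrows hcomm, hom_spechtGen_column t φ hc]
  rw [key φ, key ψ]
  ring

/-- The values of an equivariant map at the generator of a two-row Specht module are supported on
tuples with at least as many ones, and at least as many zeros, as the second row has cells. -/
theorem rowLen_one_le_of_hom_ne_zero (h2 : μ.rowLen 2 = 0) (φ : SpechtHom t) {x : BinTuple n}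
    (hx : (φ (spechtGen t)).toFun x ≠ 0) :
    μ.rowLen 1 ≤ (ones x).card ∧ (ones x).card + μ.rowLen 1 ≤ n := by
  obtain ⟨p, hcol, hpp, hrow, hor⟩ := exists_partner t h2
  have hne : ∀ i, p i ≠ i → x (p i) = !x i := fun i hi =>
    Bool.eq_not.2 fun he => hx (hom_spechtGen_eq_zero t φ hi (hcol i) he)
  have key : ∀ b : Bool, μ.rowLen 1 ≤ (Finset.univ.filter fun i => x i = b).card := by
    intro b
    rw [← card_row t 1]
    -- Every column with two cells contains each bit once; `g` sends a second-row entry to the entry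
    -- of its column that carries `b`.
    let g : Fin n → Fin n := fun i => if x i = b then i else p i
    have hg : ∀ i, (t (g i)).1.2 = (t i).1.2 := by
      intro i
      simp only [g]
      split_ifs
      · rfl
      · exact hcol i
    refine Finset.card_le_card_of_injOn g (fun i hi => ?_) fun i hi j hj hij => ?_
    · have hi1 : (t i).1.1 = 1 := by simpa using hi
      simp only [g, Finset.coe_filter, Set.mem_ofPred_eq, Finset.mem_univ, true_and]
      split_ifs with h
      · exact h
      · rw [hne i (hrow i hi1)]
        exact (Bool.eq_not.2 fun h' => h h'.symm).symm
    · have hi1 : (t i).1.1 = 1 := by simpa using hi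
      have hj1 : (t j).1.1 = 1 := by simpa using hj
      exact eq_of_row_col t (hi1.trans hj1.symm) (by rw [← hg i, ← hg j, hij])
  refine ⟨key true, ?_⟩
  have h1 := key false
  have h3 : (ones x).card + (Finset.univ.filter fun i => x i = false).card = n := by
    have := Finset.card_filter_add_card_filter_not (s := (Finset.univ : Finset (Fin n)))
      (p := fun i => x i = true)
    simpa [ones] using this
  omega

end Tableau

/-! ### Existence of equivariant maps; endomorphisms of two-row Specht modules -/

section Existence

variable {n : ℕ} {μ : YoungDiagram} (t : Fin n ≃ μ.cells)

theorem smul_toFun_eq_zero {j : ℕ} (a : ℂ[Equiv.Perm (Fin n)]) {z : BinModule n}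
    (hz : ∀ x, (ones x).card ≠ j → z.toFun x = 0) {x : BinTuple n} (hx : (ones x).card ≠ j) :
    (a • z).toFun x = 0 := by
  rw [BinModule.smul_apply]
  exact Finset.sum_eq_zero fun σ _ => by
    rw [hz _ (by rwa [card_ones_comp]), mul_zero]

theorem rowSum_smul_apply (z : BinModule n) (x : BinTuple n) :
    (rowSum t • z).toFun x =
      ∑ σ : Equiv.Perm (Fin n) with PreservesRows t σ, z.toFun (x ∘ σ) := by
  simp only [rowSum, Finset.sum_smul, BinModule.toFun_sum, BinModule.single_smul, one_mul]

theorem signedColumnSum_smul_apply (z : BinModule n) (x : BinTuple n) :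
    (signedColumnSum t • z).toFun x =
      ∑ σ : Equiv.Perm (Fin n) with PreservesColumns t σ, csign σ * z.toFun (x ∘ σ) := by
  simp only [signedColumnSum, Finset.sum_smul, BinModule.toFun_sum, BinModule.single_smul]

/-- The equivariant map on the Specht module given by right multiplication by `z`. -/
noncomputable def spechtHomOf (z : BinModule n) : SpechtHom t :=
  (LinearMap.toSpanSingleton ℂ[Equiv.Perm (Fin n)] (BinModule n) z).comp (Specht t).subtype

theorem spechtHomOf_apply (z : BinModule n) (s : Specht t) : spechtHomOf t z s = s.1 • z := rfl

/-- The Specht module of shape `(n - m, m)` has a nonzero equivariant map to the functions on the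
tuples with `j` ones whenever `m ≤ j ≤ n - m`. -/
theorem exists_smul_spechtGen_ne_zero (h2 : μ.rowLen 2 = 0) {j : ℕ} (h1 : μ.rowLen 1 ≤ j)
    (h0 : j ≤ μ.rowLen 0) :
    ∃ z : BinModule n, (∀ x, (ones x).card ≠ j → z.toFun x = 0) ∧
      spechtHomOf t z (spechtGen t) ≠ 0 := by
  classical
  -- This indicator is invariant under the row group, so `rowSum t` only multiplies it by the order
  -- of that group.
  let z : BinModule n := BinModule.ofFun fun x =>
    if (ones x).card = j ∧ ∀ i, (t i).1.1 = 1 → x i = false then 1 else 0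
  have hz : ∀ x, z.toFun x =
      if (ones x).card = j ∧ ∀ i, (t i).1.1 = 1 → x i = false then 1 else 0 := fun x => by
    simp [z]
  -- The ones fill the first `j` cells of the first row. They cover every column with two cells
  -- because the second row has at most `j` cells.
  let x₀ : BinTuple n := fun i => decide ((t i).1.1 = 0 ∧ (t i).1.2 < j)
  have hx₀ : (ones x₀).card = j := by
    have e : ones x₀ = Finset.univ.filter fun i => (t i).1.1 = 0 ∧ (t i).1.2 < j := by
      ext i
      simp [x₀]
    rw [e, card_filter_tableau t fun q => q.1 = 0 ∧ q.2 < j]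
    have e' : (μ.cells.filter fun q => q.1 = 0 ∧ q.2 < j) =
        (Finset.range j).map ⟨Prod.mk 0, Prod.mk_right_injective 0⟩ := by
      ext ⟨a, b⟩
      simp only [Finset.mem_filter, YoungDiagram.mem_cells, YoungDiagram.mem_iff_lt_rowLen,
        Finset.mem_map, Finset.mem_range, Function.Embedding.coeFn_mk, Prod.mk.injEq]
      constructor
      · rintro ⟨-, rfl, hb⟩
        exact ⟨b, hb, rfl, rfl⟩
      · rintro ⟨b, hb, rfl, rfl⟩
        exact ⟨hb.trans_le h0, rfl, hb⟩
    rw [e', Finset.card_map, Finset.card_range]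
  refine ⟨z, fun x hx => by simp [hz, hx], fun hzero => ?_⟩
  have hρ : ∀ x, (rowSum t • z).toFun x =
      (Finset.univ.filter fun σ : Equiv.Perm (Fin n) => PreservesRows t σ).card * z.toFun x := by
    intro x
    rw [rowSum_smul_apply, Finset.sum_congr rfl, Finset.sum_const, nsmul_eq_mul]
    intro σ hσ
    have hσ' : PreservesRows t σ := (Finset.mem_filter.1 hσ).2
    have : (∀ i, (t i).1.1 = 1 → (x ∘ σ) i = false) ↔ ∀ i, (t i).1.1 = 1 → x i = false := by
      refine ⟨fun h i hi => ?_, fun h i hi => h _ ((hσ' i).trans hi)⟩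
      have := h (σ.symm i) (by rw [← hσ', Equiv.apply_symm_apply, hi])
      simpa using this
    simp only [hz, card_ones_comp, this]
  have hκ : (spechtHomOf t z (spechtGen t)).toFun x₀ =
      (Finset.univ.filter fun σ : Equiv.Perm (Fin n) => PreservesRows t σ).card := by
    change ((signedColumnSum t * rowSum t) • z).toFun x₀ = _
    rw [mul_smul, signedColumnSum_smul_apply, Finset.sum_eq_single 1]
    · have hrow : ∀ i, (t i).1.1 = 1 → x₀ i = false := fun i hi => by simp [x₀, hi]
      rw [hρ, hz, Equiv.Perm.coe_one, Function.comp_id, if_pos ⟨hx₀, hrow⟩]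
      simp [csign]
    -- A column permutation that moves an entry of the second row up puts a one of `x₀` there, so
    -- its term vanishes; only the identity survives.
    · intro σ hσ hne
      have hσ' : PreservesColumns t σ := (Finset.mem_filter.1 hσ).2
      rw [hρ, hz, if_neg, mul_zero, mul_zero]
      rintro ⟨-, h⟩
      have hfix1 : ∀ i, (t i).1.1 = 1 → σ i = i := by
        intro i hi
        refine eq_of_row_col t ?_ (hσ' i)
        by_contra hr
        have hr0 : (t (σ i)).1.1 = 0 := by
          have := row_le_one t h2 (σ i)
          omega
        have hcol : (t i).1.2 < μ.rowLen 1 := by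
          have := YoungDiagram.mem_iff_lt_rowLen.1 ((YoungDiagram.mem_cells _).1 (t i).2)
          rwa [hi] at this
        have hx := h i hi
        simp only [Function.comp_apply, x₀, decide_eq_false_iff_not] at hx
        exact hx ⟨hr0, by rw [hσ']; omega⟩
      refine hne (Equiv.ext fun i => ?_)
      by_cases hi : (t i).1.1 = 1
      · exact hfix1 i hi
      · by_cases hi' : (t (σ i)).1.1 = 1
        · exact σ.injective (hfix1 _ hi')
        · have := row_le_one t h2 i
          have := row_le_one t h2 (σ i)
          exact eq_of_row_col t (by simp; omega) (hσ' i)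
    · intro h
      exact absurd (Finset.mem_filter.2 ⟨Finset.mem_univ _, fun _ => rfl⟩) h
  rw [hzero, BinModule.toFun_zero, Pi.zero_apply, eq_comm, Nat.cast_eq_zero,
    Finset.card_eq_zero] at hκ
  exact Finset.eq_empty_iff_forall_notMem.1 hκ 1
    (Finset.mem_filter.2 ⟨Finset.mem_univ _, fun _ => rfl⟩)

/-- A vector of `L(C_2^n)` whose stabilizer is the row group of a two-row tableau. -/
noncomputable def rowVector : BinModule n :=
  BinModule.ofFun (Pi.single (fun i => decide ((t i).1.1 = 1)) 1)

theorem rowVector_eq_zero {x : BinTuple n} (hx : (ones x).card ≠ μ.rowLen 1) :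
    (rowVector t).toFun x = 0 := by
  rw [rowVector, BinModule.toFun_ofFun, Pi.single_eq_of_ne]
  rintro rfl
  refine hx ?_
  rw [← card_row t 1]
  congr 1
  ext i
  simp

/-- The elements of a two-row Specht module are determined by their action on the row vector. -/
theorem spechtHomOf_rowVector_injective (h2 : μ.rowLen 2 = 0) :
    Function.Injective (spechtHomOf t (rowVector t)) := by
  classical
  refine (injective_iff_map_eq_zero _).2 fun s hs => ?_
  -- Elements of the Specht module are left multiples of `rowSum t`, so their coefficients are
  -- constant on left cosets of the row group.
  have hright : ∀ π, PreservesRows t π → s.1 * MonoidAlgebra.single π 1 = s.1 := by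
    intro π hπ
    obtain ⟨a, ha⟩ := exists_smul_spechtGen t s
    rw [ha]
    change a * (signedColumnSum t * rowSum t) * _ = a * (signedColumnSum t * rowSum t)
    rw [mul_assoc, mul_assoc, rowSum_mul_single t hπ]
  have hcoeff : ∀ π, PreservesRows t π → ∀ g, s.1.coeff (g * π) = s.1.coeff g := by
    intro π hπ g
    conv_lhs => rw [← hright π hπ]
    rw [MonoidAlgebra.coeff_mul_single_apply, mul_inv_cancel_right, mul_one]
  refine Subtype.ext (MonoidAlgebra.ext (Finsupp.ext fun g => ?_))
  -- Evaluation at the translate of the row tuple by `g` adds the coefficients over the coset of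
  -- `g`: the result is the coefficient at `g` times the order of the row group.
  have h := congrArg (fun z => z.toFun ((fun i => decide ((t i).1.1 = 1)) ∘ (g⁻¹ : Equiv.Perm (Fin n)))) hs
  simp only [spechtHomOf_apply, BinModule.smul_apply, BinModule.toFun_zero, Pi.zero_apply] at h
  rw [← Equiv.sum_comp (Equiv.mulLeft g)] at h
  have hterm : ∀ π : Equiv.Perm (Fin n), s.1.coeff (g * π) * (rowVector t).toFun
      (((fun i => decide ((t i).1.1 = 1)) ∘ (g⁻¹ : Equiv.Perm (Fin n))) ∘
        (g * π : Equiv.Perm (Fin n))) =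
      if PreservesRows t π then s.1.coeff g else 0 := by
    intro π
    have e : ((fun i => decide ((t i).1.1 = 1)) ∘ (g⁻¹ : Equiv.Perm (Fin n))) ∘
        (g * π : Equiv.Perm (Fin n)) = (fun i => decide ((t i).1.1 = 1)) ∘ π := by
      funext i
      simp
    rw [e, rowVector, BinModule.toFun_ofFun]
    split_ifs with hπ
    · rw [hcoeff π hπ]
      have : (fun i => decide ((t i).1.1 = 1)) ∘ π = fun i => decide ((t i).1.1 = 1) :=
        funext fun i => by simp [hπ i]
      rw [this, Pi.single_eq_same, mul_one]
    · rw [Pi.single_eq_of_ne, mul_zero]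
      refine fun he => hπ fun i => ?_
      have h1 := congrFun he i
      simp only [Function.comp_apply, decide_eq_decide] at h1
      have := row_le_one t h2 i
      have := row_le_one t h2 (π i)
      omega
  simp only [Equiv.coe_mulLeft, hterm] at h
  rw [← Finset.sum_filter, Finset.sum_const, nsmul_eq_mul] at h
  refine (mul_eq_zero.1 h).resolve_left ?_
  rw [Nat.cast_eq_zero]
  exact Finset.card_ne_zero_of_mem (Finset.mem_filter.2 ⟨Finset.mem_univ 1, fun _ => rfl⟩)

/-- The endomorphisms of a two-row Specht module are the scalars. -/
theorem specht_end_scalar (h2 : μ.rowLen 2 = 0)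
    (χ : Specht t →ₗ[ℂ[Equiv.Perm (Fin n)]] Specht t) : ∃ c : ℂ, ∀ s, χ s = c • s := by
  set ψ := spechtHomOf t (rowVector t) with hψ
  have hinj := spechtHomOf_rowVector_injective t h2
  have hsupp : ∀ (s : Specht t) x, (ones x).card ≠ μ.rowLen 1 → (ψ s).toFun x = 0 :=
    fun s x hx => smul_toFun_eq_zero _ (fun _ => rowVector_eq_zero t) hx
  suffices h : ∃ c : ℂ, ψ (χ (spechtGen t)) = c • ψ (spechtGen t) by
    obtain ⟨c, hc⟩ := h
    refine ⟨c, fun s => ?_⟩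
    rw [← LinearMap.map_smul_of_tower] at hc
    obtain ⟨a, rfl⟩ := exists_smul_spechtGen t s
    rw [map_smul, hinj hc, smul_comm]
  by_cases h0 : ψ (spechtGen t) = 0
  · have : spechtGen t = 0 := hinj (h0.trans (map_zero ψ).symm)
    exact ⟨0, by rw [this, map_zero, map_zero, smul_zero]⟩
  obtain ⟨y, hy⟩ : ∃ y, (ψ (spechtGen t)).toFun y ≠ 0 := by
    by_contra! h
    exact h0 (BinModule.ext fun x => by rw [h, BinModule.toFun_zero, Pi.zero_apply])
  have hy1 : (ones y).card = μ.rowLen 1 := by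
    by_contra h
    exact hy (hsupp _ y h)
  refine ⟨(ψ (χ (spechtGen t))).toFun y / (ψ (spechtGen t)).toFun y, BinModule.ext fun x => ?_⟩
  rw [BinModule.toFun_smul, Pi.smul_apply, smul_eq_mul, div_mul_eq_mul_div, eq_div_iff hy]
  by_cases hx : (ones x).card = μ.rowLen 1
  -- Both `ψ ∘ χ` and `ψ` take values supported on a single number of ones, where values at the
  -- generator are proportional.
  · exact hom_spechtGen_mul_comm t h2 (ψ ∘ₗ χ) ψ (hx.trans hy1.symm)
  · rw [hsupp _ x hx, hsupp _ x hx, zero_mul, mul_zero]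

end Existence

/-! ### Multiplicity spaces, isotypic components and kernels of tensored operators -/

section Multiplicity

variable {k A S L : Type*} [Field k] [Ring A] [Algebra k A]
  [AddCommGroup S] [Module k S] [Module A S] [IsScalarTower k A S]
  [AddCommGroup L] [Module k L] [Module A L] [IsScalarTower k A L]

/-- A projection onto a submodule is an endomorphism, hence a scalar: if the scalar is zero the
submodule is zero, otherwise it is everything. -/
theorem isSimpleModule_of_end_scalar [IsSemisimpleModule A S] [Nontrivial S]
    (hS : ∀ χ : S →ₗ[A] S, ∃ c : k, ∀ s, χ s = c • s) : IsSimpleModule A S := by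
  have : IsSimpleOrder (Submodule A S) :=
    { eq_bot_or_eq_top := fun N => by
        obtain ⟨q, hq⟩ := IsSemisimpleModule.extension_property N.subtype
          N.injective_subtype LinearMap.id
        obtain ⟨c, hc⟩ := hS (N.subtype ∘ₗ q)
        by_cases h0 : c = 0
        · left
          refine (Submodule.eq_bot_iff _).2 fun x hx => ?_
          have h1 := hc x
          have h2 : q x = ⟨x, hx⟩ := LinearMap.congr_fun hq ⟨x, hx⟩
          simpa [h0, h2] using h1
        · right
          refine (Submodule.eq_top_iff'.2 fun x => ?_)
          have h1 : x = c⁻¹ • (q x : S) := by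
            have := hc x
            simp only [LinearMap.comp_apply, Submodule.subtype_apply] at this
            rw [this, smul_smul, inv_mul_cancel₀ h0, one_smul]
          rw [h1]
          exact Submodule.smul_of_tower_mem N _ (q x).2 }
  exact { toIsSimpleOrder := this }

/-- If the endomorphisms of a semisimple module are scalars, then linearly independent maps have
independent images. -/
theorem eq_zero_of_sum_hom_eq_zero [IsSemisimpleModule A S]
    (hS : ∀ χ : S →ₗ[A] S, ∃ c : k, ∀ s, χ s = c • s) {ι : Type*} [Fintype ι]
    {b : ι → S →ₗ[A] L} (hb : LinearIndependent k b) {s : ι → S} (hs : ∑ i, b i (s i) = 0) :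
    s = 0 := by
  classical
  let Φ : (ι → S) →ₗ[A] L := ∑ i, b i ∘ₗ LinearMap.proj i
  have hΦ : ∀ s, Φ s = ∑ i, b i (s i) := fun s => by simp [Φ]
  obtain ⟨q, hq⟩ := IsSemisimpleModule.extension_property (LinearMap.ker Φ).subtype
    (LinearMap.ker Φ).injective_subtype LinearMap.id
  -- The projection `q` onto the kernel of `Φ` is a matrix of endomorphisms of `S`, that is, of
  -- scalars. Each column of it is a linear relation among the `b i`, so the projection is zero.
  choose c hc using fun i j => hS
    (LinearMap.proj i ∘ₗ (LinearMap.ker Φ).subtype ∘ₗ q ∘ₗ LinearMap.single A (fun _ => S) j)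
  have hΦq : ∀ s, Φ (q s) = 0 := fun s => (q s).2
  have hzero : ∀ j i, c i j = 0 := by
    intro j
    refine Fintype.linearIndependent_iff.1 hb _ (LinearMap.ext fun s => ?_)
    have h := hΦq (LinearMap.single A (fun _ => S) j s)
    rw [hΦ] at h
    rw [LinearMap.zero_apply, ← h, LinearMap.sum_apply]
    refine Finset.sum_congr rfl fun i _ => ?_
    rw [LinearMap.smul_apply, ← LinearMap.map_smul_of_tower, ← hc]
    rfl
  have hq0 : (LinearMap.ker Φ).subtype ∘ₗ q = 0 := by
    refine LinearMap.pi_ext' fun j => LinearMap.ext fun s => funext fun i => ?_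
    exact (hc i j s).trans (by rw [hzero, zero_smul]; rfl)
  have hmem : s ∈ LinearMap.ker Φ := (hΦ s).trans hs
  have h1 := LinearMap.congr_fun hq ⟨s, hmem⟩
  have h2 := LinearMap.congr_fun hq0 s
  simp only [LinearMap.comp_apply, Submodule.subtype_apply, LinearMap.id_apply,
    LinearMap.zero_apply] at h1 h2
  rw [h1] at h2
  exact h2

variable (k A S L) in
/-- The evaluation map `φ ⊗ s ↦ φ s`. -/
noncomputable def homEval : (S →ₗ[A] L) ⊗[k] S →ₗ[k] L :=
  TensorProduct.lift (LinearMap.mk₂ k (fun φ s => φ s) (fun _ _ _ => rfl) (fun _ _ _ => rfl)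
    (fun _ _ _ => map_add _ _ _) fun c φ s => LinearMap.map_smul_of_tower φ c s)

@[simp] theorem homEval_tmul (φ : S →ₗ[A] L) (s : S) : homEval k A S L (φ ⊗ₜ s) = φ s := rfl

theorem homEval_injective [IsSemisimpleModule A S] [FiniteDimensional k (S →ₗ[A] L)]
    (hS : ∀ χ : S →ₗ[A] S, ∃ c : k, ∀ s, χ s = c • s) :
    Function.Injective (homEval k A S L) := by
  refine (injective_iff_map_eq_zero _).2 fun u hu => ?_
  let b := Module.finBasis k (S →ₗ[A] L)
  obtain ⟨s, rfl⟩ := TensorProduct.eq_repr_basis_left b u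
  rw [Finsupp.sum_fintype _ _ fun i => TensorProduct.tmul_zero _ _] at hu ⊢
  rw [map_sum] at hu
  have h := eq_zero_of_sum_hom_eq_zero hS b.linearIndependent (s := s) hu
  simp [h]

omit [IsScalarTower k A S] in
theorem tensor_eq_zero_of_subsingleton [Subsingleton (S →ₗ[A] L)] (u : (S →ₗ[A] L) ⊗[k] S) :
    u = 0 := by
  induction u with
  | zero => rfl
  | tmul φ s => rw [Subsingleton.elim φ 0, TensorProduct.zero_tmul]
  | add u v hu hv => rw [hu, hv, add_zero]

theorem homEval_mem_isotypicComponent [IsSimpleModule A S] (u : (S →ₗ[A] L) ⊗[k] S) :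
    homEval k A S L u ∈ isotypicComponent A L S := by
  have htop : isotypicComponent A S S = ⊤ :=
    top_unique (le_sSup ⟨Submodule.topEquiv⟩)
  induction u with
  | zero => rw [map_zero]; exact Submodule.zero_mem _
  | tmul φ s =>
    have h := LinearMap.le_comap_isotypicComponent S φ
    rw [htop] at h
    exact h Submodule.mem_top
  | add u v hu hv => rw [map_add]; exact Submodule.add_mem _ hu hv

/-- Each copy of `S` in `L` is the image of a map, the inverse of the isomorphism followed by the
inclusion. Simplicity of `S` plays no role here. -/
theorem exists_homEval_eq {w : L} (hw : w ∈ isotypicComponent A L S) :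
    ∃ u, homEval k A S L u = w := by
  rw [isotypicComponent, sSup_eq_iSup'] at hw
  induction hw using Submodule.iSup_induction' with
  | mem N x hx =>
    obtain ⟨N, ⟨e⟩⟩ := N
    exact ⟨(N.subtype ∘ₗ e.symm.toLinearMap) ⊗ₜ e ⟨x, hx⟩, by simp⟩
  | zero => exact ⟨0, map_zero _⟩
  | add x y _ _ hx hy =>
    obtain ⟨u, rfl⟩ := hx
    obtain ⟨v, rfl⟩ := hy
    exact ⟨u + v, map_add _ _ _⟩

theorem homEval_map_comp (K : L →ₗ[A] L) {F : Module.End k (S →ₗ[A] L)}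
    (hF : ∀ φ, F φ = K ∘ₗ φ) (u : (S →ₗ[A] L) ⊗[k] S) :
    homEval k A S L (TensorProduct.map F LinearMap.id u) = K (homEval k A S L u) := by
  induction u with
  | zero => simp
  | tmul φ s => simp [hF]
  | add u v hu hv => rw [map_add, map_add, hu, hv, map_add, map_add]

/-- The evaluation map as an isomorphism onto the isotypic component. -/
noncomputable def isotypicEquiv (hinj : Function.Injective (homEval k A S L))
    (hmem : ∀ u, homEval k A S L u ∈ isotypicComponent A L S) :
    ((S →ₗ[A] L) ⊗[k] S) ≃ₗ[k] isotypicComponent A L S :=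
  LinearEquiv.ofBijective
    { toFun := fun u => ⟨homEval k A S L u, hmem u⟩
      map_add' := fun u v => Subtype.ext (map_add _ u v)
      map_smul' := fun c u => Subtype.ext (map_smul _ c u) }
    ⟨fun _ _ h => hinj (congrArg Subtype.val h), fun w => by
      obtain ⟨u, hu⟩ := exists_homEval_eq (k := k) w.2
      exact ⟨u, Subtype.ext hu⟩⟩

variable {V W : Type*} [AddCommGroup V] [Module k V] [AddCommGroup W] [Module k W]

/-- Over a field every module is flat, so tensoring preserves the exact sequence of the kernel. -/
theorem ker_rTensor_eq_range (f : V →ₗ[k] V) :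
    LinearMap.ker (f.rTensor W) = LinearMap.range ((LinearMap.ker f).subtype.rTensor W) :=
  (Module.Flat.rTensor_exact W (LinearMap.exact_subtype_ker_map f)).linearMap_ker_eq

theorem finrank_ker_rTensor (f : V →ₗ[k] V) :
    Module.finrank k (LinearMap.ker (f.rTensor W)) =
      Module.finrank k (LinearMap.ker f) * Module.finrank k W := by
  rw [ker_rTensor_eq_range, LinearMap.finrank_range_of_inj, Module.finrank_tensorProduct]
  exact Module.Flat.rTensor_preserves_injective_linearMap _ (LinearMap.ker f).injective_subtype

theorem ker_rTensor_congr {f g : V →ₗ[k] V} (h : LinearMap.ker f = LinearMap.ker g) :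
    LinearMap.ker (f.rTensor W) = LinearMap.ker (g.rTensor W) := by
  rw [ker_rTensor_eq_range, ker_rTensor_eq_range, h]

theorem map_id_sub_smul_one (f : Module.End k V) (z : k) :
    (TensorProduct.map f LinearMap.id : Module.End k (V ⊗[k] W)) - z • 1 =
      (f - z • 1).rTensor W := by
  rw [LinearMap.rTensor_sub, LinearMap.rTensor_smul]
  congr 2
  exact (LinearMap.rTensor_id W V).symm

theorem maxGenEigenspace_eq_eigenspace {f : Module.End k V} {z : k}
    (h : LinearMap.ker ((f - z • 1) * (f - z • 1)) = LinearMap.ker (f - z • 1)) :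
    f.maxGenEigenspace z = f.eigenspace z := by
  refine le_antisymm (fun v hv => ?_) fun v hv => ?_
  · obtain ⟨m, hm⟩ := (Module.End.mem_maxGenEigenspace f z v).1 hv
    rw [Module.End.eigenspace_def]
    induction m with
    | zero =>
      rw [pow_zero, Module.End.one_apply] at hm
      rw [hm]
      exact Submodule.zero_mem _
    | succ m ih =>
      rcases m with _ | m
      · simpa using hm
      · refine ih ?_
        rw [pow_succ', pow_succ', ← mul_assoc, Module.End.mul_apply] at hm
        have : ((f - z • 1) ^ m) v ∈ LinearMap.ker ((f - z • 1) * (f - z • 1)) := hm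
        rw [h] at this
        rw [pow_succ', Module.End.mul_apply]
        exact this
  · rw [Module.End.eigenspace_def] at hv
    exact (Module.End.mem_maxGenEigenspace f z v).2 ⟨1, by simpa using hv⟩

end Multiplicity

/-! ### Transfer of multiplicities, and operators diagonal in coordinates -/

section HasMultiplicity

variable {V W U : Type*} [AddCommGroup V] [Module ℂ V] [AddCommGroup W] [Module ℂ W]
  [AddCommGroup U] [Module ℂ U]

theorem hasMultiplicity_of_ker {f : Module.End ℂ V} {z : ℂ} {d : ℕ}
    (hd : Module.finrank ℂ (LinearMap.ker (f - z • 1)) = d)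
    (h : LinearMap.ker ((f - z • 1) * (f - z • 1)) = LinearMap.ker (f - z • 1)) :
    HasMultiplicity f z d := by
  refine ⟨?_, ?_⟩
  · rw [Module.End.eigenspace_def, hd]
  · rw [maxGenEigenspace_eq_eigenspace h, Module.End.eigenspace_def, hd]

theorem hasMultiplicity_map_id {f : Module.End ℂ V} {z : ℂ} {d : ℕ}
    (hd : Module.finrank ℂ (LinearMap.ker (f - z • 1)) = d)
    (h : LinearMap.ker ((f - z • 1) * (f - z • 1)) = LinearMap.ker (f - z • 1)) :
    HasMultiplicity (TensorProduct.map f LinearMap.id : Module.End ℂ (V ⊗[ℂ] W)) z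
      (d * Module.finrank ℂ W) := by
  refine hasMultiplicity_of_ker ?_ ?_
  · rw [map_id_sub_smul_one, finrank_ker_rTensor, hd]
  · rw [map_id_sub_smul_one]
    exact (congrArg LinearMap.ker (LinearMap.rTensor_mul W _ _).symm).trans (ker_rTensor_congr h)

theorem HasMultiplicity.of_equiv {f : Module.End ℂ V} {g : Module.End ℂ U} (e : V ≃ₗ[ℂ] U)
    (h : ∀ v, g (e v) = e (f v)) {z : ℂ} {d : ℕ} (hf : HasMultiplicity f z d) :
    HasMultiplicity g z d := by
  have hsub : ∀ v, (g - z • 1) (e v) = e ((f - z • 1) v) := fun v => by simp [h]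
  have hpow : ∀ (m : ℕ) v, ((g - z • 1) ^ m) (e v) = e (((f - z • 1) ^ m) v) := by
    intro m
    induction m with
    | zero => simp
    | succ m ih => intro v; rw [pow_succ, pow_succ, Module.End.mul_apply, hsub, ih]; rfl
  have h1 : (f.eigenspace z).map e.toLinearMap = g.eigenspace z := by
    ext u
    obtain ⟨v, rfl⟩ := e.surjective u
    simp [h, ← map_smul]
  have h2 : (f.maxGenEigenspace z).map e.toLinearMap = g.maxGenEigenspace z := by
    ext u
    obtain ⟨v, rfl⟩ := e.surjective u
    simp [Module.End.mem_maxGenEigenspace, hpow]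
  exact ⟨by rw [← h1, LinearEquiv.finrank_map_eq, hf.1],
    by rw [← h2, LinearEquiv.finrank_map_eq, hf.2]⟩

theorem hasMultiplicity_of_tensor_equiv {f : Module.End ℂ V} {g : Module.End ℂ U}
    (e : (V ⊗[ℂ] W) ≃ₗ[ℂ] U) (h : ∀ u, g (e u) = e (TensorProduct.map f LinearMap.id u))
    {z : ℂ} {d : ℕ} (hd : Module.finrank ℂ (LinearMap.ker (f - z • 1)) = d)
    (hf : LinearMap.ker ((f - z • 1) * (f - z • 1)) = LinearMap.ker (f - z • 1)) :
    HasMultiplicity g z (d * Module.finrank ℂ W) :=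
  (hasMultiplicity_map_id hd hf).of_equiv e h

theorem hasEigenvalue_iff_of_tensor_equiv {f : Module.End ℂ V} {g : Module.End ℂ U}
    (e : (V ⊗[ℂ] W) ≃ₗ[ℂ] U) (h : ∀ u, g (e u) = e (TensorProduct.map f LinearMap.id u))
    (hV : ∀ v : V, v ≠ 0 → ∃ w : W, e (v ⊗ₜ w) ≠ 0) (z : ℂ) :
    g.HasEigenvalue z ↔ f.HasEigenvalue z := by
  constructor
  · intro hg hbot
    replace hbot : f.eigenspace z = ⊥ := hbot
    rw [Module.End.eigenspace_def] at hbot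
    obtain ⟨u, hu⟩ := hg.exists_hasEigenvector
    obtain ⟨v, rfl⟩ := e.surjective u
    have hv : v ∈ LinearMap.ker ((f - z • 1).rTensor W) := by
      rw [← map_id_sub_smul_one, LinearMap.mem_ker, LinearMap.sub_apply, sub_eq_zero,
        LinearMap.smul_apply, Module.End.one_apply]
      exact e.injective (by rw [← h, hu.apply_eq_smul, map_smul])
    have hker : LinearMap.ker ((f - z • 1).rTensor W) = ⊥ :=
      LinearMap.ker_eq_bot.2 (Module.Flat.rTensor_preserves_injective_linearMap _
        (LinearMap.ker_eq_bot.1 hbot))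
    rw [hker, Submodule.mem_bot] at hv
    exact hu.2 (by rw [hv, map_zero])
  · intro hf
    obtain ⟨v, hv⟩ := hf.exists_hasEigenvector
    obtain ⟨w, hw⟩ := hV v hv.2
    refine Module.End.hasEigenvalue_of_hasEigenvector (x := e (v ⊗ₜ w)) ⟨?_, hw⟩
    rw [Module.End.mem_eigenspace_iff, h, TensorProduct.map_tmul, hv.apply_eq_smul,
      ← TensorProduct.smul_tmul', map_smul]
    rfl

variable {X : Type*} {f : Module.End ℂ V} {c : V →ₗ[ℂ] (X → ℂ)} {d : X → ℂ}

theorem coord_sub_smul_one (hf : ∀ v x, c (f v) x = d x * c v x) (z : ℂ) (v : V) (x : X) :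
    c ((f - z • 1) v) x = (d x - z) * c v x := by
  rw [LinearMap.sub_apply, map_sub, Pi.sub_apply, hf, sub_mul, LinearMap.smul_apply,
    Module.End.one_apply, map_smul, Pi.smul_apply, smul_eq_mul]

/-- The eigenvectors of an operator that is diagonal in the coordinates `c`. -/
theorem mem_ker_sub_iff_of_coord (hc : Function.Injective c)
    (hf : ∀ v x, c (f v) x = d x * c v x) {z : ℂ} {v : V} :
    v ∈ LinearMap.ker (f - z • 1) ↔ ∀ x, c v x ≠ 0 → d x = z := by
  rw [LinearMap.mem_ker, ← hc.eq_iff, map_zero, funext_iff]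
  refine forall_congr' fun x => ?_
  rw [coord_sub_smul_one hf, Pi.zero_apply, mul_eq_zero, sub_eq_zero]
  tauto

theorem ker_sub_mul_sub_of_coord (hc : Function.Injective c)
    (hf : ∀ v x, c (f v) x = d x * c v x) (z : ℂ) :
    LinearMap.ker ((f - z • 1) * (f - z • 1)) = LinearMap.ker (f - z • 1) := by
  refine le_antisymm (fun v hv => ?_) fun v hv => ?_
  · rw [mem_ker_sub_iff_of_coord hc hf]
    intro x hx
    have h := congrFun (congrArg c (LinearMap.mem_ker.1 hv)) x
    rw [Module.End.mul_apply, coord_sub_smul_one hf, coord_sub_smul_one hf, map_zero,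
      Pi.zero_apply] at h
    simpa [hx, sub_eq_zero] using h
  · rw [LinearMap.mem_ker, Module.End.mul_apply, LinearMap.mem_ker.1 hv, map_zero]

/-- Eigenvectors have coordinates supported where `d = z`, and there any two coordinate vectors are
proportional by `hprop`. -/
theorem finrank_ker_sub_eq_one_of_coord (hc : Function.Injective c)
    (hf : ∀ v x, c (f v) x = d x * c v x) {z : ℂ}
    (hprop : ∀ v w x y, d x = z → d y = z → c v x * c w y = c v y * c w x) {v : V} (hv : v ≠ 0)
    (hvz : ∀ x, c v x ≠ 0 → d x = z) : Module.finrank ℂ (LinearMap.ker (f - z • 1)) = 1 := by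
  have hvm := (mem_ker_sub_iff_of_coord hc hf).2 hvz
  obtain ⟨y, hy⟩ : ∃ y, c v y ≠ 0 := by
    by_contra! h
    exact hv (hc (by rw [map_zero]; exact funext h))
  refine (finrank_eq_one_iff_of_nonzero' (⟨v, hvm⟩ : LinearMap.ker (f - z • 1))
    fun h => hv (congrArg Subtype.val h)).2 fun w => ?_
  refine ⟨c w.1 y / c v y, Subtype.ext (hc (funext fun x => ?_))⟩
  change c ((c w.1 y / c v y) • v) x = c w.1 x
  rw [map_smul, Pi.smul_apply, smul_eq_mul, div_mul_eq_mul_div, div_eq_iff hy]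
  by_cases hx : d x = z
  · exact hprop _ _ _ _ (hvz y hy) hx
  · rw [not_imp_comm.1 (hvz x) hx,
      not_imp_comm.1 ((mem_ker_sub_iff_of_coord hc hf).1 w.2 x) hx, mul_zero, zero_mul]

theorem finrank_ker_sub_eq_zero_of_coord (hc : Function.Injective c)
    (hf : ∀ v x, c (f v) x = d x * c v x) {z : ℂ} (h : ∀ v x, c v x ≠ 0 → d x ≠ z) :
    Module.finrank ℂ (LinearMap.ker (f - z • 1)) = 0 := by
  have : LinearMap.ker (f - z • 1) = ⊥ := by
    refine (Submodule.eq_bot_iff _).2 fun v hv => hc (funext fun x => ?_)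
    rw [map_zero, Pi.zero_apply]
    by_contra hx
    exact h v x hx ((mem_ker_sub_iff_of_coord hc hf).1 hv x hx)
  rw [this, finrank_bot]

end HasMultiplicity

/-! ### The spectrum on the multiplicity spaces -/

section Spectrum

variable {n : ℕ} {μ : YoungDiagram} (t : Fin n ≃ μ.cells)

/-- The coordinates, with respect to the eigenfunctions of the Burnside operator, of the value of
an equivariant map at the generator of the Specht module. -/
noncomputable def eigenCoord : SpechtHom t →ₗ[ℂ] (BinTuple n → ℂ) where
  toFun φ := ((BinModule.eigenEquiv n).symm (φ (spechtGen t))).toFun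
  map_add' φ ψ := by rw [LinearMap.add_apply, map_add, BinModule.toFun_add]
  map_smul' c φ := by
    rw [LinearMap.smul_apply, ← LinearEquiv.coe_coe, LinearMap.map_smul_of_tower,
      BinModule.toFun_smul]
    rfl

theorem eigenCoord_injective : Function.Injective (eigenCoord t) := fun _ _ h =>
  specht_hom_ext t ((BinModule.eigenEquiv n).symm.injective (BinModule.ext fun x => congrFun h x))

theorem eigenCoord_reducedK (φ : SpechtHom t) (x : BinTuple n) :
    eigenCoord t (reducedK t φ) x = (urnEigenvalue (ones x).card : ℂ) * eigenCoord t φ x :=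
  BinModule.eigenEquiv_symm_burnsideK _ x

theorem finiteDimensional_spechtHom : FiniteDimensional ℂ (SpechtHom t) :=
  Module.Finite.of_injective (eigenCoord t) (eigenCoord_injective t)

theorem urnEigenvalue_cast_eq_iff (s k : ℕ) :
    (urnEigenvalue s : ℂ) = (burnsideBeta k : ℂ) ↔ s = 2 * k := by
  rw [Rat.cast_inj, urnEigenvalue_eq_burnsideBeta_iff]

theorem exists_eigenCoord_ne_zero {φ : SpechtHom t} (hφ : φ ≠ 0) :
    ∃ x, eigenCoord t φ x ≠ 0 := by
  by_contra! h
  exact hφ (eigenCoord_injective t (by rw [map_zero]; exact funext h))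

theorem rowLen_one_le_of_eigenCoord_ne_zero (h2 : μ.rowLen 2 = 0) {φ : SpechtHom t}
    {x : BinTuple n} (hx : eigenCoord t φ x ≠ 0) :
    μ.rowLen 1 ≤ (ones x).card ∧ (ones x).card + μ.rowLen 1 ≤ n :=
  rowLen_one_le_of_hom_ne_zero t h2 ((BinModule.eigenEquiv n).symm.toLinearMap ∘ₗ φ) hx

/-- This is Young's rule for the tuples with `2 * k` ones. The condition `2 * k ≤ n` cannot be
dropped: for `m = 0` and `2 * k > n` the truncated difference would let the inequality hold. -/
theorem finrank_eigenspace_reducedK {m k : ℕ} (hμ : IsTwoRow μ n m) :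
    Module.finrank ℂ (Module.End.eigenspace (M := SpechtHom t) (reducedK t)
      (burnsideBeta k : ℂ)) = if m ≤ min (2 * k) (n - 2 * k) ∧ 2 * k ≤ n then 1 else 0 := by
  obtain ⟨hm, h0, h1, h2⟩ := hμ
  rw [Module.End.eigenspace_def]
  split_ifs with hmk
  · rw [le_min_iff] at hmk
    obtain ⟨z, hz, hz0⟩ := exists_smul_spechtGen_ne_zero t h2 (j := 2 * k) (by omega) (by omega)
    -- Following the map given by `z` with the eigenbasis automorphism produces an eigenvector: its
    -- coordinates are the values of the original map, supported on `2 * k` ones.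
    have hφ : ∀ x, eigenCoord t (spechtHomOf t (BinModule.eigenEquiv n z)) x =
        (spechtHomOf t z (spechtGen t)).toFun x := fun x => by
      change ((BinModule.eigenEquiv n).symm
        ((spechtGen t).1 • BinModule.eigenEquiv n z)).toFun x = _
      rw [← map_smul, LinearEquiv.symm_apply_apply]
      rfl
    refine finrank_ker_sub_eq_one_of_coord (V := SpechtHom t) (eigenCoord_injective t)
      (eigenCoord_reducedK t) (fun φ ψ x y hx hy => ?_)
      (v := spechtHomOf t (BinModule.eigenEquiv n z)) ?_ fun x hx => ?_
    · rw [urnEigenvalue_cast_eq_iff] at hx hy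
      exact hom_spechtGen_mul_comm t h2 ((BinModule.eigenEquiv n).symm.toLinearMap ∘ₗ φ)
        ((BinModule.eigenEquiv n).symm.toLinearMap ∘ₗ ψ) (hx.trans hy.symm)
    · intro h
      refine hz0 (BinModule.ext fun x => ?_)
      rw [← hφ, h, map_zero, Pi.zero_apply, BinModule.toFun_zero, Pi.zero_apply]
    · rw [urnEigenvalue_cast_eq_iff]
      by_contra hne
      exact hx ((hφ x).trans (smul_toFun_eq_zero _ hz hne))
  · refine finrank_ker_sub_eq_zero_of_coord (V := SpechtHom t) (eigenCoord_injective t)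
      (eigenCoord_reducedK t) fun φ x hx hxk => hmk ?_
    rw [urnEigenvalue_cast_eq_iff] at hxk
    have := rowLen_one_le_of_eigenCoord_ne_zero t h2 hx
    rw [le_min_iff]
    omega

theorem hasEigenvalue_reducedK_iff {z : ℂ} (hz : z ≠ 0) :
    Module.End.HasEigenvalue (M := SpechtHom t) (reducedK t) z ↔
      ∃ m k : ℕ, IsTwoRow μ n m ∧ 2 * k ≤ n ∧ m ≤ min (2 * k) (n - 2 * k) ∧
        z = (burnsideBeta k : ℂ) := by
  constructor
  · intro h
    obtain ⟨φ, hφ⟩ := h.exists_hasEigenvector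
    have h2 : μ.rowLen 2 = 0 := by
      by_contra h
      exact hφ.2 (spechtHom_eq_zero t h φ)
    obtain ⟨x, hx⟩ := exists_eigenCoord_ne_zero t hφ.2
    have hzx : (urnEigenvalue (ones x).card : ℂ) = z := by
      have h := eigenCoord_reducedK t φ x
      rw [hφ.apply_eq_smul, map_smul, Pi.smul_apply, smul_eq_mul] at h
      exact (mul_right_cancel₀ hx h).symm
    have hb := rowLen_one_le_of_eigenCoord_ne_zero t h2 hx
    obtain ⟨k, hk | hk⟩ := Nat.even_or_odd' (ones x).card
    · refine ⟨μ.rowLen 1, k, isTwoRow_of_rowLen_two t h2, by omega, ?_, ?_⟩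
      · rw [le_min_iff]
        omega
      · rw [← hzx, hk, urnEigenvalue_two_mul]
    · rw [hk, urnEigenvalue_odd, Rat.cast_zero] at hzx
      exact absurd hzx.symm hz
  · rintro ⟨m, k, hμ, hk, hm, rfl⟩
    rw [Module.End.hasEigenvalue_iff]
    intro hbot
    have := finrank_eigenspace_reducedK t (k := k) hμ
    rw [hbot, if_pos ⟨hm, hk⟩, finrank_bot] at this
    exact zero_ne_one this

/-- With at least three rows the multiplicity space is zero, so scalar endomorphisms are needed only
for two-row shapes. -/
theorem homEval_specht_injective : Function.Injective
    (homEval ℂ ℂ[Equiv.Perm (Fin n)] (Specht t) (BinModule n)) := by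
  have := finiteDimensional_spechtHom t
  by_cases h2 : μ.rowLen 2 = 0
  · exact homEval_injective (specht_end_scalar t h2)
  · have : Subsingleton (SpechtHom t) :=
      ⟨fun φ ψ => (spechtHom_eq_zero t h2 φ).trans (spechtHom_eq_zero t h2 ψ).symm⟩
    exact fun u v _ => (tensor_eq_zero_of_subsingleton u).trans
      (tensor_eq_zero_of_subsingleton v).symm

theorem homEval_mem_spechtCopies (u : SpechtHom t ⊗[ℂ] Specht t) :
    homEval ℂ ℂ[Equiv.Perm (Fin n)] (Specht t) (BinModule n) u ∈ spechtCopies t := by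
  by_cases h : Subsingleton (SpechtHom t)
  · rw [show u = 0 from tensor_eq_zero_of_subsingleton u, map_zero]
    exact Submodule.zero_mem _
  · rw [not_subsingleton_iff_nontrivial] at h
    obtain ⟨φ, hφ⟩ := exists_ne (0 : SpechtHom t)
    have h2 : μ.rowLen 2 = 0 := by
      by_contra h
      exact hφ (spechtHom_eq_zero t h φ)
    -- A nonzero map out of the Specht module shows that the Young symmetrizer does not vanish.
    have : Nontrivial (Specht t) := by
      refine ⟨spechtGen t, 0, fun h0 => hφ (specht_hom_ext t ?_)⟩
      rw [h0, map_zero, map_zero]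
    have := isSimpleModule_of_end_scalar (specht_end_scalar t h2)
    exact homEval_mem_isotypicComponent u

theorem burnsideK_mem_spechtCopies {w : BinModule n} (hw : w ∈ spechtCopies t) :
    burnsideK n w ∈ spechtCopies t := by
  obtain ⟨u, rfl⟩ := exists_homEval_eq (k := ℂ) hw
  rw [← homEval_map_comp (burnsideK n) (F := reducedK t) fun _ => rfl]
  exact homEval_mem_spechtCopies t _

end Spectrum

/-! ### Transfer from the multiplicity space to the isotypic component -/

theorem corollary5p6 (n : ℕ) (μ : YoungDiagram) (t : Fin n ≃ μ.cells) :
    ∃ h : ∀ w ∈ spechtCopies t, burnsideK n w ∈ spechtCopies t,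
      (∃ e : (SpechtHom t ⊗[ℂ] Specht t) ≃ₗ[ℂ] spechtCopies t,
        (∀ (φ : SpechtHom t) (s : Specht t), (e (φ ⊗ₜ[ℂ] s) : BinModule n) = φ s) ∧
        ∀ u, restrictedK t h (e u) = e (TensorProduct.map (reducedK t) LinearMap.id u)) ∧
      (∀ m k : ℕ, IsTwoRow μ n m → 2 * k ≤ n →
        HasMultiplicity (V := SpechtHom t) (reducedK t) (burnsideBeta k : ℂ)
          (if m ≤ min (2 * k) (n - 2 * k) then 1 else 0) ∧
        HasMultiplicity (V := spechtCopies t) (restrictedK t h) (burnsideBeta k : ℂ)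
          (if m ≤ min (2 * k) (n - 2 * k) then Module.finrank ℂ (Specht t) else 0)) ∧
      (∀ z : ℂ, z ≠ 0 →
        (Module.End.HasEigenvalue (M := SpechtHom t) (reducedK t) z ↔
          ∃ m k : ℕ, IsTwoRow μ n m ∧ 2 * k ≤ n ∧ m ≤ min (2 * k) (n - 2 * k) ∧
            z = (burnsideBeta k : ℂ)) ∧
        (Module.End.HasEigenvalue (M := spechtCopies t) (restrictedK t h) z ↔
          ∃ m k : ℕ, IsTwoRow μ n m ∧ 2 * k ≤ n ∧ m ≤ min (2 * k) (n - 2 * k) ∧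
            z = (burnsideBeta k : ℂ))) := by
  let e : (SpechtHom t ⊗[ℂ] Specht t) ≃ₗ[ℂ] spechtCopies t :=
    isotypicEquiv (homEval_specht_injective t) (homEval_mem_spechtCopies t)
  have hmem : ∀ w ∈ spechtCopies t, burnsideK n w ∈ spechtCopies t :=
    fun _ => burnsideK_mem_spechtCopies t
  have he : ∀ u, restrictedK t hmem (e u) = e (TensorProduct.map (reducedK t) LinearMap.id u) :=
    fun u => Subtype.ext
      (homEval_map_comp (burnsideK n) (F := reducedK t) (fun _ => rfl) u).symm
  refine ⟨hmem, ⟨e, fun _ _ => rfl, he⟩, fun m k hμ hk => ?_, fun z hz => ?_⟩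
  · have hrank := finrank_eigenspace_reducedK t (k := k) hμ
    simp only [hk, and_true] at hrank
    rw [Module.End.eigenspace_def] at hrank
    have hker := ker_sub_mul_sub_of_coord (V := SpechtHom t) (eigenCoord_injective t)
      (eigenCoord_reducedK t) (burnsideBeta k : ℂ)
    refine ⟨hasMultiplicity_of_ker hrank hker, ?_⟩
    have hT := hasMultiplicity_of_tensor_equiv (V := SpechtHom t) (W := Specht t)
      (U := spechtCopies t) (g := restrictedK t hmem) e he hrank hker
    rw [ite_mul, one_mul, zero_mul] at hT
    exact hT
  · have hred := hasEigenvalue_reducedK_iff t hz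
    refine ⟨hred, Iff.trans ?_ hred⟩
    refine hasEigenvalue_iff_of_tensor_equiv (V := SpechtHom t) (W := Specht t) e he
      (fun φ hφ => ⟨spechtGen t, fun h => hφ (specht_hom_ext t ?_)⟩) z
    exact congrArg Subtype.val h
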